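/- All graphs are finite and simple. For a graph $G=(V,E)$ and a function $L$ assigning to each vertex $v$ a finite set $L(v)\subset\mathbb{N}$, let $\mathrm{col}(G,L)$ be the number of functions $\gamma:V\to\mathbb{N}$ with $\gamma(v)\in L(v)$ for all $v\in V$ and $\gamma(v)\neq\gamma(w)$ for all adjacent $v,w$; let $\mathrm{col}(G,n)$ be this number when $L(v)=\{1,\dots,n\}$ for every $v$. The graph $G$ is \emph{$n$-monophilic} if $\mathrm{col}(G,n)\le\mathrm{col}(G,L)$ for every $L$ with $|L(v)|=n$ for all $v\in V$. A \emph{core} of a connected graph $G$ is a subgraph obtained from $G$ by repeatedly deleting a vertex that currently has degree $1$, one vertex at a time, until no vertex of degree $1$ remains (it is unique up to isomorphism). \textbf{Theorem.} Let $G$ be a connected (non-empty) graph, and let $C$ be a core of $G$. Then $G$ is $2$-monophilic if and only if $C$ is a single vertex, or $C$ is a cycle, or $C$ is isomorphic to $K_{2,3}$, or $C$ contains an odd cycle. Equivalently, a connected graph $G$ is \emph{not} $2$-monophilic if and only if all cycles of $G$ are even and $G$ contains two distinct cycles whose union (as subgraphs of $G$) is not isomorphic to $K_{2,3}$. -/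

import Mathlib

namespace SimpleGraph

variable {V : Type*}

/-- The colorings of `G` from the list assignment `L`: the maps `γ` with `γ v ∈ L v` for every
vertex and `γ v ≠ γ w` for adjacent `v`, `w`. -/
def listColorings (G : SimpleGraph V) (L : V → Finset ℕ) : Set (V → ℕ) :=
  {γ | (∀ v, γ v ∈ L v) ∧ ∀ v w, G.Adj v w → γ v ≠ γ w}

/-- `col(G, L)`, the number of colorings of `G` from `L`; the set of colorings is finite as soon
as `V` is. -/
noncomputable def numListColorings (G : SimpleGraph V) (L : V → Finset ℕ) : ℕ :=
  (G.listColorings L).ncard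

/-- `G` is `n`-monophilic: among all `n`-list assignments, the constant one with list
`{1, …, n}` has the fewest colorings. -/
def IsMonophilic (G : SimpleGraph V) (n : ℕ) : Prop :=
  ∀ L : V → Finset ℕ, (∀ v, (L v).card = n) →
    G.numListColorings (fun _ => Finset.Icc 1 n) ≤ G.numListColorings L

/-- The subgraphs obtained from `G` by deleting, one at a time, finitely many vertices, each
having degree `1` in the subgraph from which it is deleted. -/
inductive IsPruning (G : SimpleGraph V) : G.Subgraph → Prop
  | top : IsPruning G ⊤
  | delete (H : G.Subgraph) (v : V) : IsPruning G H → v ∈ H.verts →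
      (H.neighborSet v).ncard = 1 → IsPruning G (H.deleteVerts {v})

/-- `C` is a core of `G`: a result of deleting degree-`1` vertices until none is left. For a tree
the remaining vertex depends on the order of deletion, so this is a relation. (A vertex of degree
`0` can remain only when a connected `G` is a tree; then it is the only vertex of the core.) -/
def IsCore (G : SimpleGraph V) (C : G.Subgraph) : Prop :=
  G.IsPruning C ∧ ∀ v ∈ C.verts, (C.neighborSet v).ncard ≠ 1

theorem exists_isCore [Finite V] (G : SimpleGraph V) : ∃ C : G.Subgraph, G.IsCore C := by
  obtain ⟨C, hC, hmin⟩ := exists_minimalFor_of_wellFoundedLT G.IsPruning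
    (fun H => H.verts.ncard) ⟨⊤, IsPruning.top⟩
  refine ⟨C, hC, fun v hv h1 => ?_⟩
  have hlt : (C.deleteVerts {v}).verts.ncard < C.verts.ncard := by
    rw [Subgraph.deleteVerts_verts]
    exact Set.ncard_sdiff_singleton_lt_of_mem hv
  exact absurd (hmin (IsPruning.delete C v hC hv h1) hlt.le) (not_le.mpr hlt)

/-- The graph is a single vertex. -/
def IsSingleVertex (_G : SimpleGraph V) : Prop :=
  ∃ v : V, ∀ w : V, w = v

/-- `G` is a cycle (of length at least `3`). -/
def IsCycleGraph (G : SimpleGraph V) : Prop :=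
  ∃ m : ℕ, 3 ≤ m ∧ Nonempty (G ≃g cycleGraph m)

/-- `G` is the complete bipartite graph `K_{2,3}`. -/
def IsK23 (G : SimpleGraph V) : Prop :=
  Nonempty (G ≃g completeBipartiteGraph (Fin 2) (Fin 3))

/-- `G` contains an odd cycle. -/
def HasOddCycle (G : SimpleGraph V) : Prop :=
  ∃ (v : V) (p : G.Walk v v), p.IsCycle ∧ Odd p.length

/-- All cycles of `G` are even. -/
def AllCyclesEven (G : SimpleGraph V) : Prop :=
  ∀ (v : V) (p : G.Walk v v), p.IsCycle → Even p.length

/-- `G` contains two different cycles (as subgraphs) whose union is not `K_{2,3}`. -/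
def HasTwoCyclesUnionNotK23 (G : SimpleGraph V) : Prop :=
  ∃ (u v : V) (p : G.Walk u u) (q : G.Walk v v), p.IsCycle ∧ q.IsCycle ∧
    p.toSubgraph ≠ q.toSubgraph ∧ ¬ (p.toSubgraph ⊔ q.toSubgraph).coe.IsK23

end SimpleGraph

namespace SimpleGraph

variable {V : Type*} {G : SimpleGraph V}

/-! A connected bipartite graph has exactly two colorings from {1, 2}, and a non-bipartite graph has
none. So `G` fails to be 2-monophilic exactly when it is bipartite and some assignment of 2-lists
admits at most one coloring (`HasRigidLists`, `isMonophilic_two_iff`). The rest of the proof decides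
which connected bipartite graphs have rigid lists.

Rigid lists come from two cycles. A path of length at least three can carry interior lists that
forbid one chosen pair of end colors (`exists_lists_excluding`). If all other lists are {1, 2} and
the ends are joined through them, only the two patterns `c` and `3 - c` are possible there, and two
such paths kill both. This settles cycles with at most one common vertex (`HasRigidLists.of_cycles`)
and thetas with two long arcs. Thetas of lengths 2, 2, 2k with k ≥ 2, and K_{2,4}, get explicit
lists. Distinct cycles with two common vertices contain a theta, and once these cases are excluded
only two quadrilaterals with union K_{2,3} remain (`IsPeriodicCycle.eq_four`).

Conversely, list colorings extend over deleted leaves, so rigid lists on `G` restrict to rigid lists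
on its core, while a single vertex, an even cycle and K_{2,3} have none. Every other leafless
connected bipartite graph has two cycles whose union is not K_{2,3}
(`Connected.hasTwoCyclesUnionNotK23`). Such cycles in the core are also cycles of `G`, which closes
the circle. -/

/-- Some assignment of lists of size two admits at most one coloring. -/
def HasRigidLists (G : SimpleGraph V) : Prop :=
  ∃ L : V → Finset ℕ, (∀ v, (L v).card = 2) ∧ (G.listColorings L).Subsingleton

/-- A proper coloring with the colors `1` and `2`. -/
structure IsTwoColoring (G : SimpleGraph V) (c : V → ℕ) : Prop where
  mem : ∀ v, c v = 1 ∨ c v = 2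
  ne : ∀ v w, G.Adj v w → c v ≠ c w

/-! ### Lists that exclude or determine colors -/

/-- Along a path of length at least three one can choose lists of size two on the interior so that
a given pair of colors at the ends is excluded. -/
lemma exists_lists_excluding (k : ℕ) (b : ℕ) : ∀ (f : ℕ → V) (a : ℕ),
    (∀ i j, 0 < i → i < k → 0 < j → j < k → f i = f j → i = j) →
    (3 ≤ k ∨ (k = 2 ∧ a ≠ b) ∨ (k = 1 ∧ a = b)) →
    ∃ L : V → Finset ℕ, (∀ v, (L v).card = 2) ∧ ∀ γ : V → ℕ,
      (∀ i < k, γ (f i) ≠ γ (f (i + 1))) → (∀ i, 0 < i → i < k → γ (f i) ∈ L (f i)) →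
      γ (f 0) = a → γ (f k) ≠ b := by
  classical
  induction k with
  | zero => intro f a _ h; omega
  | succ k ih =>
    intro f a hinj h
    rcases Nat.eq_zero_or_pos k with rfl | hk
    · refine ⟨fun _ => {0, 1}, fun _ => by simp, fun γ hγ _ h0 => ?_⟩
      have := hγ 0 (by omega)
      simp at this ⊢
      omega
    -- The list {a, c} on the first interior vertex forces `c` there. With one edge left, `c = b` is
    -- blocked at the end; with more edges left, a color different from both `a` and `b` keeps the
    -- induction hypothesis available.
    · obtain ⟨c, hca, hc⟩ : ∃ c, c ≠ a ∧ (3 ≤ k ∨ (k = 2 ∧ c ≠ b) ∨ (k = 1 ∧ c = b)) := by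
        rcases Nat.lt_or_ge k 2 with h1 | h2
        · exact ⟨b, by omega, by omega⟩
        · exact ⟨a + b + 1, by omega, by omega⟩
      obtain ⟨L, hL, hL'⟩ := ih (fun i => f (i + 1)) c
        (fun i j hi hi' hj hj' hij => by
          have := hinj (i + 1) (j + 1) (by omega) (by omega) (by omega) (by omega) hij
          omega) hc
      refine ⟨Function.update L (f 1) {a, c}, fun v => ?_, fun γ hγ hmem h0 => ?_⟩
      · by_cases hv : v = f 1
        · subst hv; simp [Finset.card_pair hca.symm]
        · simp [hv, hL]
      · refine hL' γ (fun i hi => hγ (i + 1) (by omega)) (fun i hi hik => ?_) ?_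
        · have := hmem (i + 1) (by omega) (by omega)
          rwa [Function.update_of_ne] at this
          intro heq
          have := hinj (i + 1) 1 (by omega) (by omega) (by omega) (by omega) heq
          omega
        · have h1 := hmem 1 (by omega) (by omega)
          have h2 := hγ 0 (by omega)
          simp only [Function.update_self, Finset.mem_insert, Finset.mem_singleton] at h1
          simp only [zero_add] at h2 ⊢
          omega

lemma IsTwoColoring.eq_iff_even {c : V → ℕ} (f : ℕ → V) (k : ℕ)
    (hmem : ∀ i ≤ k, c (f i) = 1 ∨ c (f i) = 2) (hne : ∀ i < k, c (f i) ≠ c (f (i + 1))) :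
    c (f k) = c (f 0) ↔ Even k := by
  induction k with
  | zero => simp
  | succ k ih =>
    have h1 := ih (fun i hi => hmem i (by omega)) (fun i hi => hne i (by omega))
    have h2 := hmem k (by omega)
    have h3 := hmem (k + 1) (by omega)
    have h4 := hne k (by omega)
    have h5 := hmem 0 (by omega)
    rw [Nat.even_add_one, ← h1]
    omega

/-- The interior of `f` forbids the pattern `c` at its ends, the interior of `g` forbids the swapped
pattern `3 - c` at its ends, and all other lists are {1, 2}; no coloring survives. Injectivity is
asked of interiors only, so that a cycle may serve as a path with equal ends. -/
lemma HasRigidLists.of_two_excluding {c : V → ℕ} {f g : ℕ → V} {k l : ℕ}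
    (hk : 3 ≤ k) (hl : 3 ≤ l)
    (hf : ∀ i < k, G.Adj (f i) (f (i + 1))) (hg : ∀ i < l, G.Adj (g i) (g (i + 1)))
    (hfi : ∀ i j, 0 < i → i < k → 0 < j → j < k → f i = f j → i = j)
    (hgi : ∀ i j, 0 < i → i < l → 0 < j → j < l → g i = g j → i = j)
    (hfg : ∀ i j, 0 < i → i < k → 0 < j → j < l → f i ≠ g j)
    (h : ∀ γ : V → ℕ, (∀ v w, G.Adj v w → γ v ≠ γ w) →
      (∀ v, (∀ i, 0 < i → i < k → f i ≠ v) → (∀ i, 0 < i → i < l → g i ≠ v) →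
        γ v = 1 ∨ γ v = 2) →
      (γ (f 0) = c (f 0) ∧ γ (f k) = c (f k)) ∨
        (γ (g 0) = 3 - c (g 0) ∧ γ (g l) = 3 - c (g l))) : G.HasRigidLists := by
  classical
  obtain ⟨L, hL, hL'⟩ := exists_lists_excluding k (c (f k)) f (c (f 0)) hfi (.inl hk)
  obtain ⟨M, hM, hM'⟩ := exists_lists_excluding l (3 - c (g l)) g (3 - c (g 0)) hgi (.inl hl)
  refine ⟨fun v => if ∃ i, 0 < i ∧ i < k ∧ f i = v then L v else
    if ∃ i, 0 < i ∧ i < l ∧ g i = v then M v else {1, 2}, fun v => ?_, ?_⟩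
  · dsimp only
    split_ifs
    · exact hL v
    · exact hM v
    · rfl
  · rintro γ ⟨hγ, hγ'⟩
    exfalso
    dsimp only at hγ
    have h1 := hL' γ (fun i hi => hγ' _ _ (hf i hi)) (fun i hi hi' => by
      have := hγ (f i)
      rwa [if_pos ⟨i, hi, hi', rfl⟩] at this)
    have h2 := hM' γ (fun i hi => hγ' _ _ (hg i hi)) (fun i hi hi' => by
      have := hγ (g i)
      rwa [if_neg, if_pos ⟨i, hi, hi', rfl⟩] at this
      rintro ⟨j, hj, hj', h⟩
      exact hfg _ _ hj hj' hi hi' h)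
    rcases h γ hγ' (fun v hv hv' => by
      have := hγ v
      rw [if_neg, if_neg] at this
      · simpa using this
      · rintro ⟨j, hj, hj', h⟩
        exact hv' _ hj hj' h
      · rintro ⟨j, hj, hj', h⟩
        exact hv _ hj hj' h) with h | h
    · exact h1 h.1 h.2
    · exact h2 h.1 h.2

/-- Two proper maps with values in `{1, 2}` along a walk agree at both ends or at none. -/
lemma IsTwoColoring.eq_iff_eq {c γ : V → ℕ} (f : ℕ → V) (k : ℕ)
    (hmem : ∀ i ≤ k, c (f i) = 1 ∨ c (f i) = 2) (hne : ∀ i < k, c (f i) ≠ c (f (i + 1)))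
    (hmem' : ∀ i ≤ k, γ (f i) = 1 ∨ γ (f i) = 2) (hne' : ∀ i < k, γ (f i) ≠ γ (f (i + 1))) :
    γ (f 0) = c (f 0) ↔ γ (f k) = c (f k) := by
  have h1 := IsTwoColoring.eq_iff_even f k hmem hne
  have h2 := IsTwoColoring.eq_iff_even f k hmem' hne'
  have := hmem 0 (by omega)
  have := hmem k (by omega)
  have := hmem' 0 (by omega)
  have := hmem' k (by omega)
  rw [← h2] at h1
  omega

/-- Lists determining a coloring on a nonempty set extend to lists determining it everywhere. -/
lemma HasRigidLists.of_eqOn [Finite V] (hG : G.Connected) (S : Set V) (hS : S.Nonempty)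
    (h : ∃ L : V → Finset ℕ, (∀ v, (L v).card = 2) ∧ ∀ γ γ' : V → ℕ,
      (∀ v w, G.Adj v w → γ v ≠ γ w) → (∀ v w, G.Adj v w → γ' v ≠ γ' w) →
      (∀ v ∈ S, γ v ∈ L v) → (∀ v ∈ S, γ' v ∈ L v) → Set.EqOn γ γ' S) : G.HasRigidLists := by
  classical
  -- A maximal set on which lists determine the coloring is everything: otherwise a boundary edge
  -- allows one more vertex to be added.
  obtain ⟨T, ⟨hST, hT⟩, hmax⟩ := (Set.toFinite {T : Set V | S ⊆ T ∧
    ∃ L : V → Finset ℕ, (∀ v, (L v).card = 2) ∧ ∀ γ γ' : V → ℕ,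
      (∀ v w, G.Adj v w → γ v ≠ γ w) → (∀ v w, G.Adj v w → γ' v ≠ γ' w) →
      (∀ v ∈ T, γ v ∈ L v) → (∀ v ∈ T, γ' v ∈ L v) → Set.EqOn γ γ' T}).exists_maximal
      ⟨S, subset_rfl, h⟩
  obtain ⟨L, hL, hL'⟩ := hT
  by_cases hu : T = Set.univ
  · subst hu
    exact ⟨L, hL, fun γ hγ γ' hγ' => Set.eqOn_univ _ _ |>.1
      (hL' γ γ' hγ.2 hγ'.2 (fun v _ => hγ.1 v) (fun v _ => hγ'.1 v))⟩
  exfalso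
  obtain ⟨s, hs⟩ := hS
  obtain ⟨t, ht⟩ := (Set.ne_univ_iff_exists_notMem T).1 hu
  obtain ⟨p⟩ := hG.preconnected s t
  obtain ⟨d, -, hd1, hd2⟩ := p.exists_boundary_dart T (hST hs) ht
  obtain ⟨⟨a, w⟩, haw⟩ := d
  simp only at hd1 hd2 haw
  suffices hh : insert w T ∈ {T : Set V | S ⊆ T ∧
    ∃ L : V → Finset ℕ, (∀ v, (L v).card = 2) ∧ ∀ γ γ' : V → ℕ,
      (∀ v w, G.Adj v w → γ v ≠ γ w) → (∀ v w, G.Adj v w → γ' v ≠ γ' w) →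
      (∀ v ∈ T, γ v ∈ L v) → (∀ v ∈ T, γ' v ∈ L v) → Set.EqOn γ γ' T} from
    hd2 (hmax hh (Set.subset_insert _ _) (Set.mem_insert _ _))
  refine ⟨hST.trans (Set.subset_insert _ _), ?_⟩
  have hne : ∀ v ∈ T, v ≠ w := fun v hv h => hd2 (h ▸ hv)
  by_cases hex : ∃ γ₀ : V → ℕ, (∀ v w, G.Adj v w → γ₀ v ≠ γ₀ w) ∧ ∀ v ∈ T, γ₀ v ∈ L v
  · obtain ⟨γ₀, h1, h2⟩ := hex
    -- The color of `a` is already forced to be `γ₀ a`, so this list forces its other element at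
    -- `w`.
    refine ⟨Function.update L w {γ₀ a, γ₀ a + 1}, fun v => ?_, ?_⟩
    · by_cases hv : v = w
      · subst hv; simp
      · simp [hv, hL]
    · have key : ∀ γ : V → ℕ, (∀ v w, G.Adj v w → γ v ≠ γ w) →
          (∀ v ∈ insert w T, γ v ∈ Function.update L w {γ₀ a, γ₀ a + 1} v) →
          Set.EqOn γ γ₀ T ∧ γ w = γ₀ a + 1 := by
        intro γ hγ hm
        have he : Set.EqOn γ γ₀ T := hL' γ γ₀ hγ h1 (fun v hv => by
          have := hm v (Set.mem_insert_of_mem _ hv)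
          rwa [Function.update_of_ne (hne v hv)] at this) h2
        refine ⟨he, ?_⟩
        have := hm w (Set.mem_insert _ _)
        have h3 := hγ a w haw
        rw [he hd1] at h3
        simp only [Function.update_self, Finset.mem_insert, Finset.mem_singleton] at this
        omega
      intro γ γ' hγ hγ' hm hm'
      obtain ⟨e1, e2⟩ := key γ hγ hm
      obtain ⟨e1', e2'⟩ := key γ' hγ' hm'
      rintro v (rfl | hv)
      · rw [e2, e2']
      · rw [e1 hv, e1' hv]
  · refine ⟨L, hL, fun γ γ' hγ _ hm _ => (hex ⟨γ, hγ, fun v hv => hm v ?_⟩).elim⟩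
    exact Set.mem_insert_of_mem _ hv

/-! ### Cycles, paths and thetas as functions on ℕ -/

/-- A cycle of length `m`, traversed periodically. -/
structure IsPeriodicCycle (G : SimpleGraph V) (m : ℕ) (f : ℕ → V) : Prop where
  three_le : 3 ≤ m
  adj : ∀ i, G.Adj (f i) (f (i + 1))
  periodic : ∀ i, f (i + m) = f i
  inj : ∀ i j, i < m → j < m → f i = f j → i = j

namespace IsPeriodicCycle

variable {m : ℕ} {f : ℕ → V}

lemma apply_mod (h : G.IsPeriodicCycle m f) (i : ℕ) : f (i % m) = f i :=
  Function.Periodic.map_mod_nat h.periodic i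

lemma eq_iff (h : G.IsPeriodicCycle m f) (i j : ℕ) : f i = f j ↔ i % m = j % m := by
  have := h.three_le
  refine ⟨fun hij => ?_, fun hij => by rw [← h.apply_mod i, ← h.apply_mod j, hij]⟩
  rw [← h.apply_mod i, ← h.apply_mod j] at hij
  exact h.inj _ _ (Nat.mod_lt _ (by omega)) (Nat.mod_lt _ (by omega)) hij

lemma shift (h : G.IsPeriodicCycle m f) (k : ℕ) : G.IsPeriodicCycle m (fun i => f (i + k)) where
  three_le := h.three_le
  adj i := by
    have := h.adj (i + k)
    rwa [show i + k + 1 = i + 1 + k by omega] at this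
  periodic i := by rw [show i + m + k = i + k + m by omega, h.periodic]
  inj i j hi hj hij := by
    have h1 : (i + k) ≡ (j + k) [MOD m] := (h.eq_iff _ _).1 hij
    have h2 := Nat.ModEq.add_right_cancel' k h1
    rwa [Nat.ModEq, Nat.mod_eq_of_lt hi, Nat.mod_eq_of_lt hj] at h2

lemma mem_range_shift (h : G.IsPeriodicCycle m f) (k : ℕ) :
    Set.range (fun i => f (i + k)) = Set.range f := by
  ext x
  constructor
  · rintro ⟨i, rfl⟩
    exact ⟨_, rfl⟩
  · rintro ⟨i, rfl⟩
    have := h.three_le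
    -- Adding `k` full periods keeps the natural subtraction exact.
    refine ⟨i + k * m - k, ?_⟩
    have h1 : k ≤ k * m := Nat.le_mul_of_pos_right k (by omega)
    simp only
    rw [show i + k * m - k + k = i + k * m by omega, h.eq_iff]
    simp

lemma exists_lt (h : G.IsPeriodicCycle m f) {x : V} (hx : x ∈ Set.range f) :
    ∃ i < m, f i = x := by
  obtain ⟨i, rfl⟩ := hx
  have := h.three_le
  exact ⟨i % m, Nat.mod_lt _ (by omega), h.apply_mod i⟩

lemma even {c : V → ℕ} (hc : G.IsTwoColoring c) (h : G.IsPeriodicCycle m f) : Even m := by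
  rw [← IsTwoColoring.eq_iff_even (c := c) f m (fun i _ => hc.mem _) (fun i _ => hc.ne _ _ (h.adj i))]
  have := h.periodic 0
  rw [zero_add] at this
  rw [this]

end IsPeriodicCycle

/-- Adjacency along a periodic cycle. -/
def CycleAdj (f : ℕ → V) (x y : V) : Prop :=
  ∃ i, (x = f i ∧ y = f (i + 1)) ∨ (y = f i ∧ x = f (i + 1))

/-- Reading the walk modulo its length turns rotations into shifts and arcs into intervals of
indices, which spares all surgery on walks. -/
lemma Walk.IsCycle.exists_isPeriodicCycle {u : V} {p : G.Walk u u} (hp : p.IsCycle) :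
    ∃ f : ℕ → V, G.IsPeriodicCycle p.length f ∧ (∀ x, x ∈ p.support ↔ x ∈ Set.range f) ∧
      ∀ x y, p.toSubgraph.Adj x y ↔ CycleAdj f x y := by
  have h3 := hp.three_le_length
  have hlt : ∀ i, i % p.length < p.length := fun i => Nat.mod_lt _ (by omega)
  have hsucc : ∀ i, p.getVert ((i + 1) % p.length) = p.getVert (i % p.length + 1) := by
    intro i
    have := hlt i
    rw [Nat.add_mod, Nat.mod_eq_of_lt (show 1 < p.length by omega)]
    rcases Nat.lt_or_ge (i % p.length + 1) p.length with h | h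
    · rw [Nat.mod_eq_of_lt h]
    · rw [show i % p.length + 1 = p.length by omega]
      simp
  refine ⟨fun i => p.getVert (i % p.length), ⟨h3, fun i => ?_, fun i => ?_, fun i j hi hj h => ?_⟩,
    fun x => ?_, fun x y => ?_⟩
  · rw [hsucc]
    exact p.adj_getVert_succ (hlt i)
  · simp
  · rw [Nat.mod_eq_of_lt hi, Nat.mod_eq_of_lt hj] at h
    exact hp.getVert_injOn' (by simp only [Set.mem_ofPred_eq]; omega)
      (by simp only [Set.mem_ofPred_eq]; omega) h
  · rw [Walk.mem_support_iff_exists_getVert]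
    constructor
    · rintro ⟨n, rfl, hn⟩
      rcases hn.lt_or_eq with h | rfl
      · exact ⟨n, by simp [Nat.mod_eq_of_lt h]⟩
      · exact ⟨0, by simp⟩
    · rintro ⟨i, rfl⟩
      exact ⟨_, rfl, (hlt i).le⟩
  · rw [Walk.toSubgraph_adj_iff]
    constructor
    · rintro ⟨i, h, hi⟩
      refine ⟨i, ?_⟩
      simp only [hsucc, Nat.mod_eq_of_lt hi]
      rw [Sym2.eq_iff] at h
      grind
    · rintro ⟨i, h⟩
      refine ⟨i % p.length, ?_, hlt i⟩
      simp only [hsucc] at h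
      rw [Sym2.eq_iff]
      grind

/-- `f` traverses a path of length `k` from `u` to `v`. -/
structure IsPathFun (G : SimpleGraph V) (u v : V) (k : ℕ) (f : ℕ → V) : Prop where
  start : f 0 = u
  finish : f k = v
  adj : ∀ i < k, G.Adj (f i) (f (i + 1))
  inj : ∀ i j, i ≤ k → j ≤ k → f i = f j → i = j

/-- Two paths of which no interior vertex is common. -/
def InteriorDisjoint (k : ℕ) (f : ℕ → V) (l : ℕ) (g : ℕ → V) : Prop :=
  ∀ i j, 0 < i → i < k → 0 < j → j < l → f i ≠ g j

lemma InteriorDisjoint.symm {k l : ℕ} {f g : ℕ → V} (h : InteriorDisjoint k f l g) :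
    InteriorDisjoint l g k f :=
  fun i j hi hi' hj hj' he => h j i hj hj' hi hi' he.symm

/-- Three internally disjoint paths between two different vertices. -/
structure IsTheta (G : SimpleGraph V) (u v : V) (k₁ : ℕ) (f₁ : ℕ → V) (k₂ : ℕ) (f₂ : ℕ → V)
    (k₃ : ℕ) (f₃ : ℕ → V) : Prop where
  ne : u ≠ v
  path₁ : G.IsPathFun u v k₁ f₁
  path₂ : G.IsPathFun u v k₂ f₂
  path₃ : G.IsPathFun u v k₃ f₃
  disj₁₂ : InteriorDisjoint k₁ f₁ k₂ f₂
  disj₁₃ : InteriorDisjoint k₁ f₁ k₃ f₃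
  disj₂₃ : InteriorDisjoint k₂ f₂ k₃ f₃

lemma IsPathFun.pos {u v : V} {k : ℕ} {f : ℕ → V} (h : G.IsPathFun u v k f) (huv : u ≠ v) :
    0 < k := by
  rcases Nat.eq_zero_or_pos k with rfl | h'
  · exact (huv (h.start.symm.trans h.finish)).elim
  · exact h'

lemma IsPathFun.ne_start {u v : V} {k : ℕ} {f : ℕ → V} (h : G.IsPathFun u v k f) {i : ℕ}
    (hi : 0 < i) (hi' : i < k) : f i ≠ u := by
  rw [← h.start]
  intro he
  have := h.inj _ _ hi'.le (Nat.zero_le _) he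
  omega

lemma IsPathFun.ne_finish {u v : V} {k : ℕ} {f : ℕ → V} (h : G.IsPathFun u v k f) {i : ℕ}
    (hi : i < k) : f i ≠ v := by
  rw [← h.finish]
  intro he
  have := h.inj _ _ hi.le le_rfl he
  omega

/-! ### Rigid lists on theta graphs -/

section Theta

variable {u v : V} {k₁ k₂ k₃ : ℕ} {f₁ f₂ f₃ : ℕ → V} {c : V → ℕ}

lemma IsTheta.swap₁₂ (h : G.IsTheta u v k₁ f₁ k₂ f₂ k₃ f₃) : G.IsTheta u v k₂ f₂ k₁ f₁ k₃ f₃ :=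
  ⟨h.ne, h.path₂, h.path₁, h.path₃, h.disj₁₂.symm, h.disj₂₃, h.disj₁₃⟩

lemma IsTheta.swap₂₃ (h : G.IsTheta u v k₁ f₁ k₂ f₂ k₃ f₃) : G.IsTheta u v k₁ f₁ k₃ f₃ k₂ f₂ :=
  ⟨h.ne, h.path₁, h.path₃, h.path₂, h.disj₁₃, h.disj₁₂, h.disj₂₃.symm⟩

/-- The first path keeps the lists {1, 2}, so the colors at `u` and `v` both agree with `c` or are
both swapped. One long path excludes the first possibility, the other excludes the second. -/
lemma IsTheta.hasRigidLists_of_three_le (hc : G.IsTwoColoring c)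
    (h : G.IsTheta u v k₁ f₁ k₂ f₂ k₃ f₃) (h₂ : 3 ≤ k₂) (h₃ : 3 ≤ k₃) : G.HasRigidLists := by
  refine HasRigidLists.of_two_excluding (c := c) h₂ h₃ h.path₂.adj h.path₃.adj
    (fun i j _ hi _ hj => h.path₂.inj i j hi.le hj.le)
    (fun i j _ hi _ hj => h.path₃.inj i j hi.le hj.le) h.disj₂₃ fun γ hγ hmem => ?_
  have hm : ∀ i ≤ k₁, γ (f₁ i) = 1 ∨ γ (f₁ i) = 2 := by
    intro i hi
    rcases Nat.eq_zero_or_pos i with rfl | hi0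
    · rw [h.path₁.start]
      exact hmem _ (fun j hj hj' => h.path₂.ne_start hj hj')
        (fun j hj hj' => h.path₃.ne_start hj hj')
    rcases hi.lt_or_eq with hi | rfl
    · exact hmem _ (fun j hj hj' he => h.disj₁₂ _ _ hi0 hi hj hj' he.symm)
        (fun j hj hj' he => h.disj₁₃ _ _ hi0 hi hj hj' he.symm)
    · rw [h.path₁.finish]
      exact hmem _ (fun j _ hj' => h.path₂.ne_finish hj') (fun j _ hj' => h.path₃.ne_finish hj')
  have key := IsTwoColoring.eq_iff_eq (c := c) (γ := γ) f₁ k₁ (fun i _ => hc.mem _)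
    (fun i hi => hc.ne _ _ (h.path₁.adj i hi)) hm (fun i hi => hγ _ _ (h.path₁.adj i hi))
  have a1 := hm 0 (by omega)
  have a2 := hm k₁ le_rfl
  rw [h.path₁.start, h.path₁.finish] at key
  rw [h.path₁.start] at a1
  rw [h.path₁.finish] at a2
  rw [h.path₂.start, h.path₂.finish, h.path₃.start, h.path₃.finish]
  have := hc.mem u
  have := hc.mem v
  omega

/-- These lists leave one coloring of the theta rather than none, hence the appeal to
`HasRigidLists.of_eqOn`. If `u` had color 2, then `f₁ 1` gets 1, `v` gets 3, and the list {2, 3} of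
`f₂ 1` is exhausted. So `u` has color 1; parity puts 2 at `f₃ (k₃ - 3)`, then 3 and 1 follow on the
long path, which forces 3 at `v` and 2 at both middle vertices. -/
lemma IsTheta.hasRigidLists_of_two_two [Finite V] (hG : G.Connected)
    (h : G.IsTheta u v 2 f₁ 2 f₂ k₃ f₃) (h₃ : 4 ≤ k₃) (he : Even k₃) : G.HasRigidLists := by
  classical
  have hp : ∀ i ≤ k₃, ∀ j ≤ k₃, f₃ i = f₃ j → i = j := fun i hi j hj => h.path₃.inj i j hi hj
  have e2 : ∀ i, 0 < i → i < k₃ → f₃ i ≠ f₂ 1 := fun i hi hi' =>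
    (h.disj₂₃ 1 i one_pos one_lt_two hi hi').symm
  have e1 : ∀ i, 0 < i → i < k₃ → f₃ i ≠ f₁ 1 := fun i hi hi' =>
    (h.disj₁₃ 1 i one_pos one_lt_two hi hi').symm
  have hv2 : f₂ 1 ≠ v := h.path₂.ne_finish one_lt_two
  have hu2 : f₂ 1 ≠ u := h.path₂.ne_start one_pos one_lt_two
  have hv1 : f₁ 1 ≠ v := h.path₁.ne_finish one_lt_two
  have hu1 : f₁ 1 ≠ u := h.path₁.ne_start one_pos one_lt_two
  have h12 : f₁ 1 ≠ f₂ 1 := h.disj₁₂ 1 1 one_pos one_lt_two one_pos one_lt_two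
  have a1 := h.path₁.adj 0 (by omega)
  have a2 := h.path₁.adj 1 (by omega)
  have a3 := h.path₂.adj 0 (by omega)
  have a4 := h.path₂.adj 1 (by omega)
  have a5 := h.path₃.adj (k₃ - 3) (by omega)
  have a6 := h.path₃.adj (k₃ - 2) (by omega)
  have a7 := h.path₃.adj (k₃ - 1) (by omega)
  rw [show k₃ - 3 + 1 = k₃ - 2 by omega] at a5
  rw [show k₃ - 2 + 1 = k₃ - 1 by omega] at a6
  rw [show k₃ - 1 + 1 = k₃ by omega, h.path₃.finish] at a7
  simp only [zero_add, one_add_one_eq_two, h.path₁.start, h.path₂.start, h.path₁.finish,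
    h.path₂.finish] at a1 a2 a3 a4
  refine HasRigidLists.of_eqOn hG ({u, v, f₁ 1, f₂ 1} ∪ f₃ '' {i | 0 < i ∧ i < k₃}) ⟨u, by simp⟩
    ⟨fun x => if x = v then {1, 3} else if x = f₂ 1 then {2, 3} else if x = f₃ (k₃ - 2) then {2, 3}
      else if x = f₃ (k₃ - 1) then {1, 3} else {1, 2}, fun x => ?_, ?_⟩
  · dsimp only
    split_ifs <;> rfl
  · have key : ∀ γ : V → ℕ, (∀ v w, G.Adj v w → γ v ≠ γ w) →
      (∀ x ∈ ({u, v, f₁ 1, f₂ 1} ∪ f₃ '' {i | 0 < i ∧ i < k₃} : Set V), γ x ∈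
        (if x = v then {1, 3} else if x = f₂ 1 then {2, 3} else if x = f₃ (k₃ - 2) then {2, 3}
          else if x = f₃ (k₃ - 1) then {1, 3} else {1, 2} : Finset ℕ)) →
      γ u = 1 ∧ γ v = 3 ∧ γ (f₁ 1) = 2 ∧ γ (f₂ 1) = 2 ∧ γ (f₃ (k₃ - 2)) = 3 ∧
        γ (f₃ (k₃ - 1)) = 1 ∧ ∀ i ≤ k₃ - 3, γ (f₃ i) = if Even i then 1 else 2 := by
      intro γ hγ hm
      have b1 := hm u (by simp)
      have b2 := hm v (by simp)
      have b3 := hm (f₁ 1) (by simp)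
      have b4 := hm (f₂ 1) (by simp)
      have b5 := hm (f₃ (k₃ - 2)) (.inr ⟨_, ⟨by omega, by omega⟩, rfl⟩)
      have b6 := hm (f₃ (k₃ - 1)) (.inr ⟨_, ⟨by omega, by omega⟩, rfl⟩)
      have n1 := h.path₃.ne_start (i := k₃ - 2) (by omega) (by omega)
      have n2 := h.path₃.ne_start (i := k₃ - 1) (by omega) (by omega)
      have n3 := h.path₃.ne_finish (i := k₃ - 2) (by omega)
      have n4 := h.path₃.ne_finish (i := k₃ - 1) (by omega)
      have n5 := e2 (k₃ - 2) (by omega) (by omega)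
      have n6 := e2 (k₃ - 1) (by omega) (by omega)
      have n7 := e1 (k₃ - 2) (by omega) (by omega)
      have n8 := e1 (k₃ - 1) (by omega) (by omega)
      have n9 : f₃ (k₃ - 1) ≠ f₃ (k₃ - 2) := fun he => by
        have := hp _ (by omega) _ (by omega) he
        omega
      simp only [h.ne, hu2.symm, n1.symm, n2.symm, hv1, h12, n7.symm, n8.symm,
        hv2, n3, n4, n5, n6, n9, ↓reduceIte, Finset.mem_insert, Finset.mem_singleton] at b1 b2 b3 b4 b5 b6
      have c1 : ∀ i ≤ k₃ - 3, γ (f₃ i) = 1 ∨ γ (f₃ i) = 2 := by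
        intro i hi
        rcases Nat.eq_zero_or_pos i with rfl | hi0
        · rwa [h.path₃.start]
        have := hm (f₃ i) (.inr ⟨_, ⟨by omega, by omega⟩, rfl⟩)
        rw [if_neg (h.path₃.ne_finish (by omega)), if_neg (e2 _ (by omega) (by omega)), if_neg,
          if_neg] at this
        · simpa using this
        · intro he
          have := hp _ (by omega) _ (by omega) he
          omega
        · intro he
          have := hp _ (by omega) _ (by omega) he
          omega
      have c2 : ∀ i ≤ k₃ - 3, (γ (f₃ i) = γ u ↔ Even i) := by
        intro i hi
        rw [← h.path₃.start]
        exact IsTwoColoring.eq_iff_even f₃ i (fun j hj => c1 j (by omega))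
          (fun j hj => hγ _ _ (h.path₃.adj j (by omega)))
      have c3 := c2 (k₃ - 3) le_rfl
      have c4 : ¬ Even (k₃ - 3) := by
        rw [Nat.even_sub (by omega)]
        simp only [he, true_iff]
        decide
      have c6 : γ (f₃ (k₃ - 3)) ≠ γ u := fun h => c4 (c3.1 h)
      have c5 := c1 (k₃ - 3) le_rfl
      have d1 := hγ _ _ a1
      have d2 := hγ _ _ a2
      have d3 := hγ _ _ a3
      have d4 := hγ _ _ a4
      have d5 := hγ _ _ a5
      have d6 := hγ _ _ a6
      have d7 := hγ _ _ a7
      have hu : γ u = 1 := by omega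
      refine ⟨hu, by omega, by omega, by omega, by omega, by omega, fun i hi => ?_⟩
      have c7 := c1 i hi
      split_ifs with hi'
      · rw [(c2 i hi).2 hi', hu]
      · have := (c2 i hi).not.2 hi'
        omega
    intro γ γ' hγ hγ' hm hm'
    obtain ⟨p1, p2, p3, p4, p5, p6, p7⟩ := key γ hγ hm
    obtain ⟨q1, q2, q3, q4, q5, q6, q7⟩ := key γ' hγ' hm'
    rintro x (hx | ⟨i, ⟨hi0, hi⟩, rfl⟩)
    · simp only [Set.mem_insert_iff, Set.mem_singleton_iff] at hx
      rcases hx with rfl | rfl | rfl | rfl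
      · rw [p1, q1]
      · rw [p2, q2]
      · rw [p3, q3]
      · rw [p4, q4]
    · rcases Nat.lt_or_ge (k₃ - 3) i with hi' | hi'
      · obtain rfl | rfl : i = k₃ - 2 ∨ i = k₃ - 1 := by omega
        · rw [p5, q5]
        · rw [p6, q6]
      · rw [p7 i hi', q7 i hi']

/-- Without rigid lists, a theta subgraph of a bipartite graph is `K_{2,3}`. -/
lemma IsTheta.eq_two [Finite V] (hG : G.Connected) (hc : G.IsTwoColoring c)
    (hr : ¬ G.HasRigidLists) (h : G.IsTheta u v k₁ f₁ k₂ f₂ k₃ f₃)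
    (h₁₂ : ¬ (k₁ = 1 ∧ k₂ = 1)) (h₁₃ : ¬ (k₁ = 1 ∧ k₃ = 1)) (h₂₃ : ¬ (k₂ = 1 ∧ k₃ = 1)) :
    k₁ = 2 ∧ k₂ = 2 ∧ k₃ = 2 := by
  -- Bipartiteness gives the three lengths a common parity. At most one of them is at least 3; odd
  -- lengths would then make two of them 1, and even lengths make two of them 2, with the third
  -- unable to exceed 2.
  have par : ∀ k f, G.IsPathFun u v k f → (c v = c u ↔ Even k) := by
    intro k f hf
    have := IsTwoColoring.eq_iff_even (c := c) f k (fun i _ => hc.mem _)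
      (fun i hi => hc.ne _ _ (hf.adj i hi))
    rwa [hf.start, hf.finish] at this
  have e1 := par _ _ h.path₁
  have e2 := par _ _ h.path₂
  have e3 := par _ _ h.path₃
  rw [Nat.even_iff] at e1 e2 e3
  have q12 : k₁ % 2 = k₂ % 2 := by omega
  have q13 : k₁ % 2 = k₃ % 2 := by omega
  clear e1 e2 e3
  have p1 := h.path₁.pos h.ne
  have p2 := h.path₂.pos h.ne
  have p3 := h.path₃.pos h.ne
  have t23 : ¬ (3 ≤ k₂ ∧ 3 ≤ k₃) := fun ⟨a, b⟩ => hr (h.hasRigidLists_of_three_le hc a b)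
  have t13 : ¬ (3 ≤ k₁ ∧ 3 ≤ k₃) := fun ⟨a, b⟩ => hr (h.swap₁₂.hasRigidLists_of_three_le hc a b)
  have t12 : ¬ (3 ≤ k₁ ∧ 3 ≤ k₂) := fun ⟨a, b⟩ =>
    hr (h.swap₂₃.swap₁₂.hasRigidLists_of_three_le hc a b)
  have s3 : ¬ (k₁ = 2 ∧ k₂ = 2 ∧ 4 ≤ k₃ ∧ k₃ % 2 = 0) := by
    rintro ⟨rfl, rfl, a, b⟩
    exact hr (h.hasRigidLists_of_two_two hG a (Nat.even_iff.2 b))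
  have s2 : ¬ (k₁ = 2 ∧ k₃ = 2 ∧ 4 ≤ k₂ ∧ k₂ % 2 = 0) := by
    rintro ⟨rfl, rfl, a, b⟩
    exact hr (h.swap₂₃.hasRigidLists_of_two_two hG a (Nat.even_iff.2 b))
  have s1 : ¬ (k₂ = 2 ∧ k₃ = 2 ∧ 4 ≤ k₁ ∧ k₁ % 2 = 0) := by
    rintro ⟨rfl, rfl, a, b⟩
    exact hr (h.swap₁₂.swap₂₃.hasRigidLists_of_two_two hG a (Nat.even_iff.2 b))
  clear par hr h
  rcases Nat.lt_or_ge k₁ 3 with g1 | g1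
  · rcases Nat.lt_or_ge k₂ 3 with g2 | g2
    · clear t12 t13 t23 s1 s2
      interval_cases k₁ <;> interval_cases k₂ <;> omega
    · have g3 : k₃ < 3 := by by_contra hh; exact t23 ⟨g2, by omega⟩
      clear t12 t13 t23 s1 s3
      interval_cases k₁ <;> interval_cases k₃ <;> omega
  · have g2 : k₂ < 3 := by by_contra hh; exact t12 ⟨g1, by omega⟩
    have g3 : k₃ < 3 := by by_contra hh; exact t13 ⟨g1, by omega⟩
    clear t12 t13 t23 s2 s3
    interval_cases k₂ <;> interval_cases k₃ <;> omega

end Theta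

/-! ### K_{2,4} and pairs of cycles -/

/-- The lists of `u` and `v` are {1, 2} and {3, 4}, and the other four lists are the four pairs {i,
j} with one color from each. Whatever `u` and `v` choose, the vertex carrying that pair is blocked.
-/
lemma HasRigidLists.of_completeBipartite_two_four {u v x y z t : V}
    (hd : [u, v, x, y, z, t].Nodup) (hx : G.Adj u x ∧ G.Adj v x) (hy : G.Adj u y ∧ G.Adj v y)
    (hz : G.Adj u z ∧ G.Adj v z) (ht : G.Adj u t ∧ G.Adj v t) : G.HasRigidLists := by
  classical
  refine ⟨fun w => if w = v then {3, 4} else if w = x then {1, 3} else if w = y then {1, 4} else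
    if w = z then {2, 3} else if w = t then {2, 4} else {1, 2}, fun w => ?_, ?_⟩
  · dsimp only
    split_ifs <;> rfl
  · rintro γ ⟨hγ, hγ'⟩
    exfalso
    simp only [List.nodup_cons, List.mem_cons, List.not_mem_nil, or_false, not_or] at hd
    have a1 := hγ u
    have a2 := hγ v
    have a3 := hγ x
    have a4 := hγ y
    have a5 := hγ z
    have a6 := hγ t
    have b1 := hγ' _ _ hx.1
    have b2 := hγ' _ _ hx.2
    have b3 := hγ' _ _ hy.1
    have b4 := hγ' _ _ hy.2
    have b5 := hγ' _ _ hz.1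
    have b6 := hγ' _ _ hz.2
    have b7 := hγ' _ _ ht.1
    have b8 := hγ' _ _ ht.2
    simp only [hd, eq_comm, if_true, if_false, Finset.mem_insert,
      Finset.mem_singleton] at a1 a2 a3 a4 a5 a6
    grind

lemma IsPeriodicCycle.eq_of_lt_add {m : ℕ} {f : ℕ → V} (h : G.IsPeriodicCycle m f) {i j : ℕ}
    (hij : i ≤ j) (hj : j < i + m) (he : f i = f j) : i = j := by
  have h1 : i ≡ j [MOD m] := (h.eq_iff _ _).1 he
  rw [Nat.modEq_iff_dvd' hij] at h1
  have := Nat.eq_zero_of_dvd_of_lt h1 (by omega)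
  omega

lemma IsPeriodicCycle.exists_shift {m : ℕ} {f : ℕ → V} (h : G.IsPeriodicCycle m f) {x : V}
    (hx : x ∈ Set.range f) :
    ∃ f' : ℕ → V, G.IsPeriodicCycle m f' ∧ Set.range f' = Set.range f ∧ f' 0 = x := by
  obtain ⟨i, rfl⟩ := hx
  exact ⟨_, h.shift i, h.mem_range_shift i, by simp⟩

/-- Two even cycles with at most one common vertex in a connected bipartite graph. -/
lemma HasRigidLists.of_cycles (hG : G.Connected) {c : V → ℕ} (hc : G.IsTwoColoring c) {m n : ℕ}
    {f g : ℕ → V} (hf : G.IsPeriodicCycle m f) (hg : G.IsPeriodicCycle n g)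
    (h : ∀ x y, x ∈ Set.range f → x ∈ Set.range g → y ∈ Set.range f → y ∈ Set.range g → x = y) :
    G.HasRigidLists := by
  classical
  -- A shortest walk between the cycles carries lists {1, 2} and transports the pattern from one
  -- attaching point to the other. Each cycle, started at its attaching point, is a closed path
  -- excluding one of the two colors there.
  have hex : ∃ d, ∃ x ∈ Set.range f, ∃ y ∈ Set.range g, ∃ p : G.Walk x y, p.length = d := by
    obtain ⟨p⟩ := hG.preconnected (f 0) (g 0)
    exact ⟨_, _, ⟨0, rfl⟩, _, ⟨0, rfl⟩, p, rfl⟩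
  have hmin := fun d => Nat.find_min hex (m := d)
  obtain ⟨x, hx, y, hy, p, hp⟩ := Nat.find_spec hex
  rw [← hp] at hmin
  clear hp hex
  obtain ⟨f', hf', hrf, rfl⟩ := hf.exists_shift hx
  obtain ⟨g', hg', hrg, rfl⟩ := hg.exists_shift hy
  rw [← hrf, ← hrg] at hmin h
  have inj0 : ∀ {m : ℕ} {f : ℕ → V}, G.IsPeriodicCycle m f → ∀ i, 0 < i → i < m → f i ≠ f 0 :=
    fun hf i hi hi' he => by
      have := hf.inj i 0 hi' (by omega) he
      omega
  have hlast : ∀ {m : ℕ} {f : ℕ → V}, G.IsPeriodicCycle m f → f m = f 0 := fun hf => by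
    have := hf.periodic 0
    rwa [zero_add] at this
  refine HasRigidLists.of_two_excluding (c := c) hf'.three_le hg'.three_le (fun i _ => hf'.adj i)
    (fun i _ => hg'.adj i) (fun i j _ hi _ hj => hf'.inj i j hi hj)
    (fun i j _ hi _ hj => hg'.inj i j hi hj) (fun i j hi hi' hj hj' he => ?_) fun γ hγ hmem => ?_
  -- A common vertex makes the shortest walk trivial, so the attaching points coincide and already
  -- are the only common vertex.
  · have h0 : p.length = 0 := by
      by_contra h0
      exact hmin 0 (by omega) ⟨f' i, ⟨i, rfl⟩, f' i, ⟨j, he.symm⟩, .nil, rfl⟩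
    have hxy := Walk.eq_of_length_eq_zero h0
    exact inj0 hf' i hi hi' (h _ _ ⟨i, rfl⟩ ⟨j, he.symm⟩ ⟨0, rfl⟩ ⟨0, hxy.symm⟩)
  · have hm : ∀ i ≤ p.length, γ (p.getVert i) = 1 ∨ γ (p.getVert i) = 2 := by
      intro i hi
      refine hmem _ (fun j hj hj' he => ?_) (fun j hj hj' he => ?_)
      · rcases Nat.eq_zero_or_pos i with rfl | hi0
        · rw [Walk.getVert_zero] at he
          exact inj0 hf' j hj hj' he
        · exact hmin (p.length - i) (by omega) ⟨_, ⟨j, he⟩, _, ⟨0, rfl⟩, p.drop i, by simp⟩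
      · rcases hi.lt_or_eq with hi | rfl
        · exact hmin i (by omega) ⟨_, ⟨0, rfl⟩, _, ⟨j, he⟩, p.take i, by simp; omega⟩
        · rw [Walk.getVert_length] at he
          exact inj0 hg' j hj hj' he
    have key := IsTwoColoring.eq_iff_eq (c := c) (γ := γ) p.getVert p.length (fun i _ => hc.mem _)
      (fun i hi => hc.ne _ _ (p.adj_getVert_succ hi)) hm
      (fun i hi => hγ _ _ (p.adj_getVert_succ hi))
    have a1 := hm 0 (by omega)
    have a2 := hm _ le_rfl
    rw [Walk.getVert_zero] at a1 key
    rw [Walk.getVert_length] at a2 key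
    rw [hlast hf', hlast hg']
    have := hc.mem (f' 0)
    have := hc.mem (g' 0)
    omega

/-- A cycle with an edge off another cycle, the two having two common vertices, contains an ear of
the other one. -/
lemma IsPeriodicCycle.exists_ear {n : ℕ} {f g : ℕ → V} (hg : G.IsPeriodicCycle n g)
    (hne : ∃ x y, CycleAdj g x y ∧ ¬ CycleAdj f x y)
    (hcom : ∃ x y, x ≠ y ∧ x ∈ Set.range f ∧ x ∈ Set.range g ∧ y ∈ Set.range f ∧
      y ∈ Set.range g) :
    ∃ i k, 0 < k ∧ k < n ∧ g i ∈ Set.range f ∧ g (i + k) ∈ Set.range f ∧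
      (∀ j, 0 < j → j < k → g (i + j) ∉ Set.range f) ∧
      (k = 1 → ¬ CycleAdj f (g i) (g (i + 1))) := by
  classical
  obtain ⟨x, y, ⟨j₀, hj₀⟩, hxy⟩ := hne
  obtain ⟨s, t, hst, hs, hs', ht, ht'⟩ := hcom
  obtain ⟨a, ha, rfl⟩ := hg.exists_lt hs'
  obtain ⟨b, hb, rfl⟩ := hg.exists_lt ht'
  -- The ear runs from the last index up to `J` on `f` to the first index beyond `J` on `f`, and so
  -- contains the edge at `J`, which is off `f`. The added period guarantees a common vertex at or
  -- before `J`.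
  set J := j₀ + n with hJ
  set i := Nat.findGreatest (fun i => g i ∈ Set.range f) J with hi
  have hi1 : g i ∈ Set.range f :=
    Nat.findGreatest_spec (P := fun i => g i ∈ Set.range f) (show a ≤ J by omega) hs
  have hiJ : i ≤ J := Nat.findGreatest_le J
  have hi2 : ∀ l, i < l → l ≤ J → g l ∉ Set.range f := fun l h1 h2 =>
    Nat.findGreatest_is_greatest h1 h2
  -- A common vertex other than `g i` recurs at `i + r` with `0 < r < n`, which bounds the length of
  -- the ear below `n`.
  obtain ⟨t, htF, htne⟩ : ∃ t, g t ∈ Set.range f ∧ t % n ≠ i % n := by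
    by_cases h : a % n = i % n
    · refine ⟨b, ht, fun h' => hst ?_⟩
      rw [hg.eq_iff, h, h']
    · exact ⟨a, hs, h⟩
  set r := (t + n * i - i) % n with hr
  have h3 := hg.three_le
  have hni : i ≤ n * i := Nat.le_mul_of_pos_left i (by omega)
  have hrt : (i + r) % n = t % n := by
    rw [hr, Nat.add_mod_mod, show i + (t + n * i - i) = t + n * i by omega]
    simp
  have hr0 : r ≠ 0 := by
    intro h
    rw [h, add_zero] at hrt
    exact htne hrt.symm
  have hrn : r < n := Nat.mod_lt _ (by omega)
  have hrF : g (i + r) ∈ Set.range f := by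
    rw [(hg.eq_iff _ _).2 hrt]
    exact htF
  have hrJ : J < i + r := by
    by_contra h
    exact hi2 _ (by omega) (by omega) hrF
  have hex : ∃ e, J < e ∧ g e ∈ Set.range f := ⟨_, hrJ, hrF⟩
  obtain ⟨he1, he2⟩ := Nat.find_spec hex
  have he3 := Nat.find_min' hex ⟨hrJ, hrF⟩
  have he4 := fun d => Nat.find_min hex (m := d)
  set e := Nat.find hex
  refine ⟨i, e - i, by omega, by omega, hi1, by rwa [show i + (e - i) = e by omega], ?_, ?_⟩
  · intro j hj hj' hjF
    rcases Nat.lt_or_ge J (i + j) with h | h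
    · exact he4 (i + j) (by omega) ⟨h, hjF⟩
    · exact hi2 _ (by omega) h hjF
  · intro hk hadj
    have hiJ : i = j₀ + n := by omega
    rw [hiJ, show j₀ + n + 1 = j₀ + 1 + n by omega, hg.periodic, hg.periodic] at hadj
    apply hxy
    rcases hj₀ with ⟨rfl, rfl⟩ | ⟨rfl, rfl⟩
    · exact hadj
    · obtain ⟨l, hl⟩ := hadj
      exact ⟨l, by tauto⟩

/-- The ends of the ear cut `f` into two arcs, and these with the ear form a theta. By
`IsTheta.eq_two` all three paths have length 2; an ear of length 1 is a chord by `h1`, so no two of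
the paths are the same edge. -/
lemma IsPeriodicCycle.four_of_ear [Finite V] (hG : G.Connected) {c : V → ℕ}
    (hc : G.IsTwoColoring c) (hr : ¬ G.HasRigidLists) {m n : ℕ} {f g : ℕ → V}
    (hf : G.IsPeriodicCycle m f) (hg : G.IsPeriodicCycle n g) {i k : ℕ} (hk : 0 < k) (hkn : k < n)
    (hi : g i ∈ Set.range f) (hik : g (i + k) ∈ Set.range f)
    (hint : ∀ j, 0 < j → j < k → g (i + j) ∉ Set.range f)
    (h1 : k = 1 → ¬ CycleAdj f (g i) (g (i + 1))) :
    m = 4 ∧ k = 2 ∧ ∃ a, f a = g i ∧ f (a + 2) = g (i + 2) := by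
  obtain ⟨a, ha⟩ := hi
  have hfa := hf.shift a
  rw [← hf.mem_range_shift a] at hik
  obtain ⟨b, hbm, hb⟩ := hfa.exists_lt hik
  have hne : g i ≠ g (i + k) := fun he => by
    have := hg.eq_of_lt_add (by omega) (by omega) he
    omega
  have hb0 : b ≠ 0 := by
    rintro rfl
    rw [zero_add, ha] at hb
    exact hne hb
  have h3 := hf.three_le
  have hlast : f (m + a) = g i := by rw [add_comm, hf.periodic, ha]
  have theta : G.IsTheta (g i) (g (i + k)) b (fun j => f (j + a)) (m - b) (fun j => f (m - j + a))
      k (fun j => g (i + j)) := by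
    refine ⟨hne, ⟨by simpa using ha, hb, fun j _ => hfa.adj j,
      fun s t hs ht he => hfa.inj s t (by omega) (by omega) he⟩,
      ⟨by simpa using hlast, ?_, fun j hj => ?_, fun s t hs ht he => ?_⟩,
      ⟨rfl, rfl, fun j _ => hg.adj _, fun s t hs ht he => ?_⟩, ?_, ?_, ?_⟩
    · rw [show m - (m - b) = b by omega, hb]
    · have := hf.adj (m - (j + 1) + a)
      rw [show m - (j + 1) + a + 1 = m - j + a by omega] at this
      exact this.symm
    · rcases le_total s t with h | h
      · have := hf.eq_of_lt_add (by omega) (by omega) he.symm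
        omega
      · have := hf.eq_of_lt_add (by omega) (by omega) he
        omega
    · rcases le_total s t with h | h
      · have := hg.eq_of_lt_add (by omega) (by omega) he
        omega
      · have := hg.eq_of_lt_add (by omega) (by omega) he.symm
        omega
    · intro s t hs hs' ht ht' he
      have := hf.eq_of_lt_add (by omega) (by omega) he
      omega
    · intro s t hs hs' ht ht' he
      exact hint t ht ht' ⟨_, he⟩
    · intro s t hs hs' ht ht' he
      exact hint t ht ht' ⟨_, he⟩
  obtain ⟨e1, e2, e3⟩ := theta.eq_two hG hc hr (by omega) (by
    rintro ⟨rfl, rfl⟩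
    refine h1 rfl ⟨a, .inl ⟨ha.symm, ?_⟩⟩
    rw [← hb, add_comm]) (by
    rintro ⟨hb', rfl⟩
    refine h1 rfl ⟨b + a, .inr ⟨hb.symm, ?_⟩⟩
    rw [← hlast, show b + a + 1 = m + a by omega])
  subst e1 e3
  exact ⟨by omega, rfl, a, ha, by rw [← hb, add_comm]⟩

lemma IsPeriodicCycle.range_eq_of_four {f : ℕ → V} (hf : G.IsPeriodicCycle 4 f) (a : ℕ) :
    Set.range f = {f a, f (a + 1), f (a + 2), f (a + 3)} := by
  rw [← hf.mem_range_shift a]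
  ext x
  constructor
  · intro hx
    obtain ⟨i, hi, rfl⟩ := (hf.shift a).exists_lt hx
    interval_cases i <;> simp [add_comm]
  · rintro (rfl | rfl | rfl | rfl)
    exacts [⟨0, by simp⟩, ⟨1, by simp [add_comm]⟩, ⟨2, by simp [add_comm]⟩, ⟨3, by simp [add_comm]⟩]

lemma IsPeriodicCycle.cycleAdj_iff {n : ℕ} {g : ℕ → V} (hg : G.IsPeriodicCycle n g) (i : ℕ)
    (x : V) : CycleAdj g (g i) x ↔ x = g (i + 1) ∨ x = g (i + (n - 1)) := by
  have h3 := hg.three_le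
  constructor
  · rintro ⟨j, ⟨h1, rfl⟩ | ⟨rfl, h1⟩⟩
    · left
      rw [hg.eq_iff] at h1 ⊢
      exact (Nat.ModEq.add_right 1 h1).symm
    · right
      rw [hg.eq_iff] at h1 ⊢
      have h2 : i + (n - 1) ≡ j + 1 + (n - 1) [MOD n] := Nat.ModEq.add_right _ h1
      rw [show j + 1 + (n - 1) = j + n by omega] at h2
      rw [h2, Nat.add_mod_right]
  · rintro (rfl | rfl)
    · exact ⟨i, .inl ⟨rfl, rfl⟩⟩
    · refine ⟨i + (n - 1), .inr ⟨rfl, ?_⟩⟩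
      rw [show i + (n - 1) + 1 = i + n by omega, hg.periodic]

/-- Without rigid lists, two different cycles of a connected bipartite graph are two of the
quadrilaterals of a `K_{2,3}`. -/
lemma IsPeriodicCycle.eq_four [Finite V] (hG : G.Connected) {c : V → ℕ}
    (hc : G.IsTwoColoring c) (hr : ¬ G.HasRigidLists) {m n : ℕ} {f g : ℕ → V}
    (hf : G.IsPeriodicCycle m f) (hg : G.IsPeriodicCycle n g)
    (hne : ∃ x y, CycleAdj g x y ∧ ¬ CycleAdj f x y) :
    m = 4 ∧ n = 4 ∧ ∃ a i, f a = g i ∧ f (a + 2) = g (i + 2) ∧ g (i + 1) ∉ Set.range f ∧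
      (g (i + 3) = f (a + 1) ∨ g (i + 3) = f (a + 3)) := by
  have hcom : ∃ x y, x ≠ y ∧ x ∈ Set.range f ∧ x ∈ Set.range g ∧ y ∈ Set.range f ∧
      y ∈ Set.range g := by
    by_contra! hcom
    exact hr (HasRigidLists.of_cycles hG hc hf hg fun x y h1 h2 h3 h4 => by
      by_contra h
      exact hcom x y h h1 h2 h3 h4)
  obtain ⟨i, k, hk, hkn, hi, hik, hint, h1⟩ := hg.exists_ear hne hcom
  obtain ⟨rfl, rfl, a, ha, ha2⟩ := hf.four_of_ear hG hc hr hg hk hkn hi hik hint h1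
  have hz := hint 1 one_pos one_lt_two
  -- If every edge of `f` were on `g`, both `f`-neighbors of `f a = g i` would be `g`-neighbors. One
  -- `g`-neighbor, `g (i + 1)`, is off `f`, leaving a single vertex for both. The ear argument with
  -- the roles exchanged then gives `n = 4`.
  have hne' : ∃ x y, CycleAdj f x y ∧ ¬ CycleAdj g x y := by
    by_contra! hcon
    have b1 := hcon (f a) (f (a + 1)) ⟨a, .inl ⟨rfl, rfl⟩⟩
    have b2 := hcon (f a) (f (a + 3)) ((hf.cycleAdj_iff a _).2 (.inr rfl))
    rw [ha, hg.cycleAdj_iff] at b1 b2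
    have b3 := b1.resolve_left fun h => hz ⟨_, h⟩
    have b4 := b2.resolve_left fun h => hz ⟨_, h⟩
    have := hf.eq_of_lt_add (by omega) (by omega) (b3.trans b4.symm)
    omega
  obtain ⟨x, y, hxy, hx1, hx2, hy1, hy2⟩ := hcom
  obtain ⟨i', k', hk', hkn', hi', hik', hint', h1'⟩ :=
    hf.exists_ear hne' ⟨x, y, hxy, hx2, hx1, hy2, hy1⟩
  obtain ⟨rfl, -⟩ := hg.four_of_ear hG hc hr hf hk' hkn' hi' hik' hint' h1'
  refine ⟨rfl, rfl, a, i, ha, ha2, hz, ?_⟩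
  have gne : ∀ s t, s < t → t < s + 4 → g (i + s) ≠ g (i + t) := fun s t h1 h2 he => by
    have := hg.eq_of_lt_add (by omega) (by omega) he
    omega
  have fne : ∀ s t, s < t → t < s + 4 → f (a + s) ≠ f (a + t) := fun s t h1 h2 he => by
    have := hf.eq_of_lt_add (by omega) (by omega) he
    omega
  have g03 := gne 0 3 (by omega) (by omega)
  have g23 := gne 2 3 (by omega) (by omega)
  rw [← ha2] at g23
  rw [add_zero, ← ha] at g03
  -- Otherwise `f a` and `f (a + 2)` have four common neighbors, a K_{2,4}.
  by_contra! ht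
  have hrange := hf.range_eq_of_four a
  rw [hrange] at hz
  simp only [Set.mem_insert_iff, Set.mem_singleton_iff, not_or] at hz
  apply hr
  have f4 : f (a + 3 + 1) = f a := hf.periodic a
  have g4 : g (i + 3 + 1) = g i := hg.periodic i
  refine HasRigidLists.of_completeBipartite_two_four (u := f a) (v := f (a + 2)) (x := f (a + 1))
    (y := f (a + 3)) (z := g (i + 1)) (t := g (i + 3)) ?_ ⟨hf.adj a, (hf.adj (a + 1)).symm⟩
    ⟨?_, hf.adj (a + 2)⟩ ⟨?_, ?_⟩ ⟨?_, ?_⟩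
  · have f01 := fne 0 1 (by omega) (by omega)
    have f02 := fne 0 2 (by omega) (by omega)
    have f03 := fne 0 3 (by omega) (by omega)
    have f12 := fne 1 2 (by omega) (by omega)
    have f13 := fne 1 3 (by omega) (by omega)
    have f23 := fne 2 3 (by omega) (by omega)
    have g13 := gne 1 3 (by omega) (by omega)
    simp only [add_zero] at f01 f02 f03
    simp only [List.nodup_cons, List.mem_cons, List.not_mem_nil, or_false, not_or]
    grind
  · rw [← f4]; exact (hf.adj _).symm
  · rw [ha]; exact hg.adj _
  · rw [ha2]; exact (hg.adj (i + 1)).symm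
  · rw [ha, ← g4]; exact (hg.adj (i + 3)).symm
  · rw [ha2]; exact hg.adj (i + 2)

/-- A bipartite graph on `u, v, x, y, z` in which `u, v` are adjacent to `x, y, z`. -/
lemma IsTwoColoring.isK23 {c : V → ℕ} (hc : G.IsTwoColoring c) {u v x y z : V}
    (hd : [u, v, x, y, z].Nodup) (hall : ∀ w, w ∈ [u, v, x, y, z])
    (hx : G.Adj u x ∧ G.Adj v x) (hy : G.Adj u y ∧ G.Adj v y) (hz : G.Adj u z ∧ G.Adj v z) :
    G.IsK23 := by
  simp only [List.nodup_cons, List.mem_cons, List.not_mem_nil, or_false, not_or] at hd hall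
  have huv : c u = c v := by
    have := hc.ne _ _ hx.1
    have := hc.ne _ _ hx.2
    have := hc.mem u
    have := hc.mem v
    have := hc.mem x
    omega
  have hxy : c x = c y ∧ c x = c z := by
    have := hc.ne _ _ hx.1
    have := hc.ne _ _ hy.1
    have := hc.ne _ _ hz.1
    have := hc.mem u
    have := hc.mem y
    have := hc.mem x
    have := hc.mem z
    omega
  have nadj : ∀ a b, c a = c b → ¬ G.Adj a b := fun a b h hab => hc.ne _ _ hab h
  have hbij : Function.Bijective (Sum.elim ![u, v] ![x, y, z] : Fin 2 ⊕ Fin 3 → V) := by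
    constructor
    · rintro (a | a) (b | b) hab <;> fin_cases a <;> fin_cases b <;> simp_all
    · intro w
      rcases hall w with rfl | rfl | rfl | rfl | rfl
      exacts [⟨.inl 0, rfl⟩, ⟨.inl 1, rfl⟩, ⟨.inr 0, rfl⟩, ⟨.inr 1, rfl⟩, ⟨.inr 2, rfl⟩]
  refine ⟨Iso.symm ⟨Equiv.ofBijective _ hbij, ?_⟩⟩
  rintro (a | a) (b | b)
  · have : ¬ G.Adj (![u, v] a) (![u, v] b) := by
      apply nadj
      fin_cases a <;> fin_cases b <;> simp [huv]
    simpa using this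
  · have : G.Adj (![u, v] a) (![x, y, z] b) := by
      fin_cases a <;> fin_cases b <;> simp [hx, hy, hz]
    simpa using this
  · have : G.Adj (![x, y, z] a) (![u, v] b) := by
      fin_cases a <;> fin_cases b <;> simp [hx, hy, hz, G.adj_comm x, G.adj_comm y, G.adj_comm z]
    simpa using this
  · have : ¬ G.Adj (![x, y, z] a) (![x, y, z] b) := by
      apply nadj
      fin_cases a <;> fin_cases b <;> simp [← hxy.1, ← hxy.2]
    simpa using this

lemma IsTwoColoring.coe {c : V → ℕ} (hc : G.IsTwoColoring c) (S : G.Subgraph) :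
    S.coe.IsTwoColoring (fun v => c v) :=
  ⟨fun v => hc.mem v, fun _ _ h => hc.ne _ _ (S.adj_sub h)⟩

lemma IsTwoColoring.isK23_sup {c : V → ℕ} (hc : G.IsTwoColoring c) (hr : ¬ G.HasRigidLists)
    [Finite V] (hG : G.Connected) {u v : V} {p : G.Walk u u} {q : G.Walk v v} (hp : p.IsCycle)
    (hq : q.IsCycle) (hne : ∃ x y, q.toSubgraph.Adj x y ∧ ¬ p.toSubgraph.Adj x y) :
    (p.toSubgraph ⊔ q.toSubgraph).coe.IsK23 := by
  obtain ⟨f, hf, hfs, hfa⟩ := hp.exists_isPeriodicCycle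
  obtain ⟨g, hg, hgs, hga⟩ := hq.exists_isPeriodicCycle
  simp only [hfa, hga] at hne
  obtain ⟨hm, hn, a, i, h0, h2, h1, h3⟩ := hf.eq_four hG hc hr hg hne
  rw [hm] at hf
  rw [hn] at hg
  have rf := hf.range_eq_of_four a
  have rg := hg.range_eq_of_four i
  have hverts : ∀ w, w ∈ (p.toSubgraph ⊔ q.toSubgraph).verts ↔
      w ∈ [f a, f (a + 2), f (a + 1), f (a + 3), g (i + 1)] := by
    intro w
    rw [Subgraph.verts_sup, Set.mem_union, Walk.mem_verts_toSubgraph, Walk.mem_verts_toSubgraph,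
      hfs, hgs, rf, rg]
    simp only [Set.mem_insert_iff, Set.mem_singleton_iff, List.mem_cons, List.not_mem_nil, or_false]
    grind
  have fne : ∀ s t, s < t → t < s + 4 → f (a + s) ≠ f (a + t) := fun s t h1 h2 he => by
    have := hf.eq_of_lt_add (by omega) (by omega) he
    omega
  have f01 := fne 0 1 (by omega) (by omega)
  have f02 := fne 0 2 (by omega) (by omega)
  have f03 := fne 0 3 (by omega) (by omega)
  have f12 := fne 1 2 (by omega) (by omega)
  have f13 := fne 1 3 (by omega) (by omega)
  have f23 := fne 2 3 (by omega) (by omega)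
  rw [rf] at h1
  simp only [Set.mem_insert_iff, Set.mem_singleton_iff, not_or, add_zero] at h1 f01 f02 f03
  refine (hc.coe _).isK23 (u := ⟨f a, (hverts _).2 (by simp)⟩)
    (v := ⟨f (a + 2), (hverts _).2 (by simp)⟩) (x := ⟨f (a + 1), (hverts _).2 (by simp)⟩)
    (y := ⟨f (a + 3), (hverts _).2 (by simp)⟩) (z := ⟨g (i + 1), (hverts _).2 (by simp)⟩)
    ?_ ?_ ?_ ?_ ?_
  · simp only [List.nodup_cons, List.mem_cons, List.not_mem_nil, or_false, not_or, Subtype.mk.injEq]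
    grind
  · rintro ⟨w, hw⟩
    have := (hverts w).1 hw
    simpa using this
  all_goals simp only [Subgraph.coe_adj, Subgraph.sup_adj, hfa, hga]
  · exact ⟨.inl ⟨a, .inl ⟨rfl, rfl⟩⟩, .inl ⟨a + 1, .inr ⟨rfl, rfl⟩⟩⟩
  · exact ⟨.inl ⟨a + 3, .inr ⟨rfl, (hf.periodic a).symm⟩⟩, .inl ⟨a + 2, .inl ⟨rfl, rfl⟩⟩⟩
  · exact ⟨.inr ⟨i, .inl ⟨h0, rfl⟩⟩, .inr ⟨i + 1, .inr ⟨rfl, h2⟩⟩⟩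

lemma HasTwoCyclesUnionNotK23.hasRigidLists [Finite V] (hG : G.Connected) {c : V → ℕ}
    (hc : G.IsTwoColoring c) (h : G.HasTwoCyclesUnionNotK23) : G.HasRigidLists := by
  by_contra hr
  obtain ⟨u, v, p, q, hp, hq, hne, hK⟩ := h
  by_cases h1 : ∃ x y, q.toSubgraph.Adj x y ∧ ¬ p.toSubgraph.Adj x y
  · exact hK (hc.isK23_sup hr hG hp hq h1)
  by_cases h2 : ∃ x y, p.toSubgraph.Adj x y ∧ ¬ q.toSubgraph.Adj x y
  · rw [sup_comm] at hK
    exact hK (hc.isK23_sup hr hG hq hp h2)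
  -- Every vertex of a cycle lies on one of its edges, so cycles with the same edges are the same
  -- subgraph.
  push Not at h1 h2
  apply hne
  obtain ⟨f, hf, hfs, hfa⟩ := hp.exists_isPeriodicCycle
  obtain ⟨g, hg, hgs, hga⟩ := hq.exists_isPeriodicCycle
  refine Subgraph.ext ?_ ?_
  · ext x
    rw [Walk.mem_verts_toSubgraph, Walk.mem_verts_toSubgraph]
    constructor
    · rw [hfs]
      rintro ⟨i, rfl⟩
      exact Walk.mem_support_of_adj_toSubgraph (h2 _ _ ((hfa _ (f (i + 1))).2 ⟨i, .inl ⟨rfl, rfl⟩⟩))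
    · rw [hgs]
      rintro ⟨i, rfl⟩
      exact Walk.mem_support_of_adj_toSubgraph (h1 _ _ ((hga _ (g (i + 1))).2 ⟨i, .inl ⟨rfl, rfl⟩⟩))
  · ext x y
    exact ⟨h2 x y, h1 x y⟩

/-! ### From monophily to rigid lists -/

lemma mem_listColorings_Icc {c : V → ℕ} :
    c ∈ G.listColorings (fun _ => Finset.Icc 1 2) ↔ G.IsTwoColoring c := by
  constructor
  · rintro ⟨h1, h2⟩
    exact ⟨fun v => by have := Finset.mem_Icc.1 (h1 v); omega, h2⟩
  · rintro ⟨h1, h2⟩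
    exact ⟨fun v => Finset.mem_Icc.2 (by have := h1 v; omega), h2⟩

lemma finite_listColorings [Finite V] (L : V → Finset ℕ) : (G.listColorings L).Finite :=
  (Set.Finite.pi' fun v => (L v).finite_toSet).subset fun _ hγ v => hγ.1 v

lemma IsTwoColoring.swap {c : V → ℕ} (hc : G.IsTwoColoring c) :
    G.IsTwoColoring (fun v => 3 - c v) :=
  ⟨fun v => by have := hc.mem v; omega, fun v w h => by
    have := hc.mem v
    have := hc.mem w
    have := hc.ne v w h
    omega⟩

lemma IsTwoColoring.eq_or_eq_swap (hG : G.Connected) {c γ : V → ℕ} (hc : G.IsTwoColoring c)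
    (hγ : G.IsTwoColoring γ) : γ = c ∨ γ = fun v => 3 - c v := by
  obtain ⟨s⟩ := hG.nonempty
  have key : ∀ v, γ s = c s ↔ γ v = c v := by
    intro v
    obtain ⟨p⟩ := hG.preconnected s v
    have := IsTwoColoring.eq_iff_eq (c := c) (γ := γ) p.getVert p.length (fun i _ => hc.mem _)
      (fun i hi => hc.ne _ _ (p.adj_getVert_succ hi)) (fun i _ => hγ.mem _)
      (fun i hi => hγ.ne _ _ (p.adj_getVert_succ hi))
    rwa [Walk.getVert_zero, Walk.getVert_length] at this
  by_cases h : γ s = c s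
  · exact .inl (funext fun v => (key v).1 h)
  · refine .inr (funext fun v => ?_)
    have := (key v).not.1 h
    have := hc.mem v
    have := hγ.mem v
    omega

/-- A connected graph is `2`-monophilic unless it is bipartite and has rigid lists. -/
lemma isMonophilic_two_iff [Finite V] (hG : G.Connected) :
    G.IsMonophilic 2 ↔ ∀ c, G.IsTwoColoring c → ¬ G.HasRigidLists := by
  constructor
  · rintro h c hc ⟨L, hL, hs⟩
    have h1 := h L hL
    have h2 : G.numListColorings L ≤ 1 := by
      rw [numListColorings, Set.ncard_le_one (finite_listColorings L)]
      exact fun a ha b hb => hs ha hb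
    have h3 : 1 < G.numListColorings (fun _ => Finset.Icc 1 2) := by
      rw [numListColorings, Set.one_lt_ncard (finite_listColorings _)]
      obtain ⟨s⟩ := hG.nonempty
      refine ⟨c, mem_listColorings_Icc.2 hc, _, mem_listColorings_Icc.2 hc.swap, fun he => ?_⟩
      have := congrFun he s
      have := hc.mem s
      omega
    omega
  · intro h L hL
    by_cases hc : ∃ c, G.IsTwoColoring c
    · obtain ⟨c, hc⟩ := hc
      have h1 : G.numListColorings (fun _ => Finset.Icc 1 2) ≤ 2 := by
        refine (Set.ncard_le_ncard (t := {c, fun v => 3 - c v}) ?_ (Set.toFinite _)).trans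
          ((Set.ncard_insert_le _ _).trans_eq (by rw [Set.ncard_singleton]))
        intro γ hγ
        exact hc.eq_or_eq_swap hG (mem_listColorings_Icc.1 hγ)
      have h2 : 1 < G.numListColorings L := by
        by_contra hlt
        rw [not_lt, numListColorings, Set.ncard_le_one (finite_listColorings L)] at hlt
        exact h c hc ⟨L, hL, fun a ha b hb => hlt a ha b hb⟩
      omega
    · have : G.listColorings (fun _ => Finset.Icc 1 2) = ∅ :=
        Set.eq_empty_of_forall_notMem fun γ hγ => hc ⟨γ, mem_listColorings_Icc.1 hγ⟩
      rw [numListColorings, this, Set.ncard_empty]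
      exact Nat.zero_le _

lemma exists_ne_of_card_eq_two {s : Finset ℕ} (hs : s.card = 2) (x : ℕ) : ∃ y ∈ s, y ≠ x :=
  Finset.exists_mem_ne (by omega) x

/-! ### Pruning leaves -/

/-- List colorings of a pruning extend to the whole graph. -/
lemma IsPruning.exists_extension {H : G.Subgraph} (hH : G.IsPruning H) {L : V → Finset ℕ}
    (hL : ∀ v, (L v).card = 2) : ∀ γ : V → ℕ, (∀ v ∈ H.verts, γ v ∈ L v) →
    (∀ v w, H.Adj v w → γ v ≠ γ w) → ∃ γ' ∈ G.listColorings L, Set.EqOn γ' γ H.verts := by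
  classical
  induction hH with
  | top => exact fun γ h1 h2 => ⟨γ, ⟨fun v => h1 v trivial, fun v w h => h2 v w h⟩, fun _ _ => rfl⟩
  | delete H v _ hv hdeg ih =>
    intro γ h1 h2
    obtain ⟨w, hw⟩ := Set.ncard_eq_one.1 hdeg
    have hnb : ∀ x, H.Adj v x ↔ x = w := fun x => by
      rw [← Subgraph.mem_neighborSet, hw, Set.mem_singleton_iff]
    -- The restored leaf has one neighbor, so one of its two colors is free.
    obtain ⟨y, hy, hyw⟩ := exists_ne_of_card_eq_two (hL v) (γ w)
    have hwv : w ≠ v := fun h => H.loopless.irrefl v ((hnb v).2 h.symm)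
    obtain ⟨γ', hγ', he⟩ := ih (Function.update γ v y) (fun x hx => by
      by_cases hxv : x = v
      · subst hxv; simpa using hy
      · rw [Function.update_of_ne hxv]
        exact h1 x (by simp [hx, hxv])) (fun a b hab => by
      by_cases hav : a = v
      · subst hav
        obtain rfl := (hnb b).1 hab
        rwa [Function.update_self, Function.update_of_ne hwv]
      by_cases hbv : b = v
      · subst hbv
        obtain rfl := (hnb a).1 hab.symm
        rw [Function.update_self, Function.update_of_ne hwv]
        exact hyw.symm
      rw [Function.update_of_ne hav, Function.update_of_ne hbv]
      refine h2 a b ?_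
      rw [Subgraph.deleteVerts_adj]
      exact ⟨hab.fst_mem, by simpa using hav, hab.snd_mem, by simpa using hbv, hab⟩)
    refine ⟨γ', hγ', fun x hx => ?_⟩
    rw [Subgraph.deleteVerts_verts] at hx
    rw [he hx.1, Function.update_of_ne (by simpa using hx.2)]

lemma IsPruning.exists_extension_coe {H : G.Subgraph} (hH : G.IsPruning H) {L : V → Finset ℕ}
    (hL : ∀ v, (L v).card = 2) {γ : H.verts → ℕ} (hγ : γ ∈ H.coe.listColorings fun v => L v) :
    ∃ γ' ∈ G.listColorings L, ∀ v : H.verts, γ' v = γ v := by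
  have hval : ∀ v : H.verts, Function.extend Subtype.val γ 0 v = γ v :=
    fun v => Subtype.val_injective.extend_apply _ _ _
  obtain ⟨γ', h1, h2⟩ := hH.exists_extension hL (Function.extend Subtype.val γ 0)
    (fun v hv => by rw [hval ⟨v, hv⟩]; exact hγ.1 ⟨v, hv⟩)
    (fun v w hvw => by
      rw [hval ⟨v, hvw.fst_mem⟩, hval ⟨w, hvw.snd_mem⟩]
      exact hγ.2 ⟨v, hvw.fst_mem⟩ ⟨w, hvw.snd_mem⟩ hvw)
  exact ⟨γ', h1, fun v => by rw [h2 v.2, hval]⟩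

/-- Two different colorings of the pruning would extend to two different colorings of `G`. -/
lemma IsPruning.hasRigidLists_coe {H : G.Subgraph} (hH : G.IsPruning H) (h : G.HasRigidLists) :
    H.coe.HasRigidLists := by
  obtain ⟨L, hL, hs⟩ := h
  refine ⟨fun v => L v, fun v => hL v, fun γ hγ γ' hγ' => funext fun v => ?_⟩
  obtain ⟨δ, h1, h2⟩ := hH.exists_extension_coe hL hγ
  obtain ⟨δ', h1', h2'⟩ := hH.exists_extension_coe hL hγ'
  rw [← h2 v, ← h2' v, hs h1 h1']

lemma IsPruning.exists_isTwoColoring {H : G.Subgraph} (hH : G.IsPruning H)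
    (h : ∃ c, H.coe.IsTwoColoring c) : ∃ c, G.IsTwoColoring c := by
  obtain ⟨c, hc⟩ := h
  obtain ⟨γ, h1, -⟩ := hH.exists_extension_coe (L := fun _ => Finset.Icc 1 2) (fun _ => rfl)
    (mem_listColorings_Icc.2 hc)
  exact ⟨γ, mem_listColorings_Icc.1 h1⟩

/-! ### Graphs without rigid lists: a single vertex, K_{2,3}, even cycles -/

lemma IsSingleVertex.not_hasRigidLists (h : G.IsSingleVertex) : ¬ G.HasRigidLists := by
  rintro ⟨L, hL, hs⟩
  obtain ⟨v, hv⟩ := h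
  obtain ⟨a, b, hab, hLv⟩ := Finset.card_eq_two.1 (hL v)
  have key : ∀ x ∈ L v, (fun _ => x) ∈ G.listColorings L := fun x hx =>
    ⟨fun w => hv w ▸ hx, fun y z hyz => (hyz.ne ((hv y).trans (hv z).symm)).elim⟩
  exact hab (congrFun (hs (key a (by simp [hLv])) (key b (by simp [hLv]))) v)

lemma Iso.hasRigidLists {W : Type*} {K : SimpleGraph W} (e : G ≃g K) (h : G.HasRigidLists) :
    K.HasRigidLists := by
  obtain ⟨L, hL, hs⟩ := h
  refine ⟨fun w => L (e.symm w), fun w => hL _, fun γ hγ γ' hγ' => ?_⟩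
  have key : ∀ γ ∈ K.listColorings (fun w => L (e.symm w)), γ ∘ e ∈ G.listColorings L :=
    fun γ hγ => ⟨fun v => by simpa using hγ.1 (e v), fun v w hvw => hγ.2 _ _ (e.map_adj_iff.2 hvw)⟩
  funext w
  simpa using congrFun (hs (key γ hγ) (key γ' hγ')) (e.symm w)

/-- Call a choice of colors on the side of two alive if it extends to the side of three. A choice is
dead only when some list on the side of three is contained in it. Under rigidity at most one choice
is alive, and comparing these few blocking lists gives a contradiction. -/
lemma not_hasRigidLists_completeBipartiteGraph :
    ¬ (completeBipartiteGraph (Fin 2) (Fin 3)).HasRigidLists := by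
  classical
  rintro ⟨L, hL, hs⟩
  have mk : ∀ s ∈ L (.inl 0), ∀ t ∈ L (.inl 1), ∀ y : Fin 3 → ℕ,
      (∀ j, y j ∈ L (.inr j) ∧ y j ≠ s ∧ y j ≠ t) → Sum.elim ![s, t] y ∈
        (completeBipartiteGraph (Fin 2) (Fin 3)).listColorings L := by
    intro s hs t ht y hy
    refine ⟨?_, ?_⟩
    · rintro (i | j)
      · fin_cases i
        exacts [hs, ht]
      · exact (hy j).1
    · rintro (i | i) (j | j) hij
      · simp at hij
      · have := hy j
        fin_cases i
        exacts [this.2.1.symm, this.2.2.symm]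
      · have := hy i
        fin_cases j
        exacts [this.2.1, this.2.2]
      · simp at hij
  have dead : ∀ s t s' t', s ∈ L (.inl 0) → t ∈ L (.inl 1) → s' ∈ L (.inl 0) → t' ∈ L (.inl 1) →
      (s ≠ s' ∨ t ≠ t') → (∀ j, ∃ y ∈ L (.inr j), y ≠ s ∧ y ≠ t) →
      ∃ j, ∀ y ∈ L (.inr j), y = s' ∨ y = t' := by
    intro s t s' t' h1 h2 h3 h4 hne ha
    by_contra! hcon
    choose y hy using ha
    choose y' hy' using hcon
    have he := hs (mk s h1 t h2 y hy) (mk s' h3 t' h4 y' hy')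
    have e0 := congrFun he (.inl 0)
    have e1 := congrFun he (.inl 1)
    simp at e0 e1
    tauto
  have pair : ∀ j s t, (∀ y ∈ L (.inr j), y = s ∨ y = t) → L (.inr j) = {s, t} := by
    intro j s t h
    refine Finset.eq_of_subset_of_card_le (fun y hy => by simpa using h y hy) ?_
    rw [hL]
    exact Finset.card_le_two
  -- If (s, t) is alive then (s', t') is dead, so a vertex on the side of three has list {s', t'}.
  -- Both of its colors are compatible with (s, t), giving two colorings.
  have fin : ∀ s s' t t', L (.inl 0) = {s, s'} → L (.inl 1) = {t, t'} → s ≠ s' → t ≠ t' →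
      s ≠ t' → s' ≠ t → s' ≠ t' → ¬ ∀ j, ∃ y ∈ L (.inr j), y ≠ s ∧ y ≠ t := by
    intro s s' t t' hu hv h1 h2 h3 h4 h5 ha
    obtain ⟨j₁, h₁⟩ := dead s t s t' (by simp [hu]) (by simp [hv]) (by simp [hu]) (by simp [hv])
      (.inr h2) ha
    obtain ⟨j₂, h₂⟩ := dead s t s' t (by simp [hu]) (by simp [hv]) (by simp [hu]) (by simp [hv])
      (.inl h1) ha
    obtain ⟨j₃, h₃⟩ := dead s t s' t' (by simp [hu]) (by simp [hv]) (by simp [hu]) (by simp [hv])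
      (.inl h1) ha
    choose y hy using ha
    have m₃ := pair _ _ _ h₃
    have key : ∀ x ∈ L (.inr j₃), Sum.elim ![s, t] (Function.update y j₃ x) ∈
        (completeBipartiteGraph (Fin 2) (Fin 3)).listColorings L := by
      intro x hx
      refine mk s (by simp [hu]) t (by simp [hv]) _ fun j => ?_
      by_cases hj : j = j₃
      · subst hj
        rw [Function.update_self]
        refine ⟨hx, ?_⟩
        rw [m₃] at hx
        simp only [Finset.mem_insert, Finset.mem_singleton] at hx
        omega
      · rw [Function.update_of_ne hj]
        exact hy j
    have he := congrFun (hs (key s' (by simp [m₃])) (key t' (by simp [m₃]))) (.inr j₃)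
    simp at he
    exact h5 he
  have other : ∀ w, ∀ s ∈ L w, ∃ s', L w = {s, s'} ∧ s ≠ s' := by
    intro w s hs
    obtain ⟨a, b, hab, h⟩ := Finset.card_eq_two.1 (hL w)
    rw [h] at hs ⊢
    simp only [Finset.mem_insert, Finset.mem_singleton] at hs
    rcases hs with rfl | rfl
    · exact ⟨b, rfl, hab⟩
    · exact ⟨a, Finset.pair_comm _ _, hab.symm⟩
  -- Choosing a common color at both vertices is always alive, since it removes at most one color
  -- from each list.
  have diag : ∀ a j, ∃ y ∈ L (.inr j), y ≠ a ∧ y ≠ a := fun a j => by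
    obtain ⟨y, hy, hya⟩ := exists_ne_of_card_eq_two (hL (.inr j)) a
    exact ⟨y, hy, hya, hya⟩
  by_cases hcom : ∃ a, a ∈ L (.inl 0) ∧ a ∈ L (.inl 1)
  · obtain ⟨a, h0, h1⟩ := hcom
    obtain ⟨s', hs', hs1⟩ := other _ a h0
    obtain ⟨t', ht', ht1⟩ := other _ a h1
    by_cases hst : s' = t'
    · subst hst
      obtain ⟨j, hj⟩ := dead a a s' s' h0 h1 (by simp [hs']) (by simp [ht']) (.inl hs1) (diag a)
      obtain ⟨y, hy, hys⟩ := exists_ne_of_card_eq_two (hL (.inr j)) s'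
      have := hj y hy
      tauto
    · exact fin a s' a t' hs' ht' hs1 ht1 ht1 hs1.symm hst (diag a)
  -- With disjoint lists all four choices are dead by `fin`, and they need four different blocking
  -- lists on only three vertices.
  · push Not at hcom
    obtain ⟨a, a', ha, hu⟩ := Finset.card_eq_two.1 (hL (.inl 0))
    obtain ⟨b, b', hb, hv⟩ := Finset.card_eq_two.1 (hL (.inl 1))
    have c1 : a ≠ b := fun h => hcom a (by simp [hu]) (by simp [hv, h])
    have c2 : a ≠ b' := fun h => hcom a (by simp [hu]) (by simp [hv, h])
    have c3 : a' ≠ b := fun h => hcom a' (by simp [hu]) (by simp [hv, h])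
    have c4 : a' ≠ b' := fun h => hcom a' (by simp [hu]) (by simp [hv, h])
    have hu' := hu.trans (Finset.pair_comm _ _)
    have hv' := hv.trans (Finset.pair_comm _ _)
    have d1 := fin a a' b b' hu hv ha hb c2 c3 c4
    have d2 := fin a a' b' b hu hv' ha hb.symm c1 c4 c3
    have d3 := fin a' a b b' hu' hv ha.symm hb c4 c1 c2
    have d4 := fin a' a b' b hu' hv' ha.symm hb.symm c3 c2 c1
    push Not at d1 d2 d3 d4
    have mem : ∀ j s t, (∀ y ∈ L (.inr j), y ≠ s → y = t) → L (.inr j) = {s, t} := fun j s t h =>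
      pair j s t fun y hy => by have := h y hy; tauto
    obtain ⟨j₁, e₁⟩ := d1
    obtain ⟨j₂, e₂⟩ := d2
    obtain ⟨j₃, e₃⟩ := d3
    obtain ⟨j₄, e₄⟩ := d4
    replace e₁ := mem _ _ _ e₁
    replace e₂ := mem _ _ _ e₂
    replace e₃ := mem _ _ _ e₃
    replace e₄ := mem _ _ _ e₄
    have dis : ∀ (x y z w : ℕ) (i j : Fin 3), L (.inr i) = {x, y} → L (.inr j) = {z, w} →
        ((x ≠ z ∧ x ≠ w) ∨ (y ≠ z ∧ y ≠ w)) → i ≠ j := by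
      rintro x y z w i j h1 h2 h3 rfl
      rw [h1] at h2
      have p1 : x ∈ ({z, w} : Finset ℕ) := h2 ▸ by simp
      have p2 : y ∈ ({z, w} : Finset ℕ) := h2 ▸ by simp
      simp only [Finset.mem_insert, Finset.mem_singleton] at p1 p2
      omega
    have q12 := dis _ _ _ _ _ _ e₁ e₂ (.inr ⟨c1.symm, hb⟩)
    have q13 := dis _ _ _ _ _ _ e₁ e₃ (.inl ⟨ha, c1⟩)
    have q14 := dis _ _ _ _ _ _ e₁ e₄ (.inl ⟨ha, c2⟩)
    have q23 := dis _ _ _ _ _ _ e₂ e₃ (.inl ⟨ha, c1⟩)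
    have q24 := dis _ _ _ _ _ _ e₂ e₄ (.inl ⟨ha, c2⟩)
    have q34 := dis _ _ _ _ _ _ e₃ e₄ (.inr ⟨c3.symm, hb⟩)
    omega

/-- Colorings of the path `0, …, m - 1` from the lists `l`. -/
structure IsSeqColoring (m : ℕ) (l : ℕ → Finset ℕ) (g : ℕ → ℕ) : Prop where
  mem : ∀ i < m, g i ∈ l i
  ne : ∀ i, i + 1 < m → g i ≠ g (i + 1)

lemma exists_isSeqColoring (m : ℕ) {l : ℕ → Finset ℕ} (hl : ∀ i, (l i).card = 2) {a : ℕ}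
    (ha : a ∈ l 0) : ∃ g, g 0 = a ∧ IsSeqColoring m l g := by
  choose next h1 h2 using fun (i x : ℕ) => exists_ne_of_card_eq_two (hl (i + 1)) x
  refine ⟨fun n => Nat.rec a next n, rfl, fun i _ => ?_, fun i _ => (h2 i _).symm⟩
  cases i with
  | zero => exact ha
  | succ i => exact h1 i _

/-- Otherwise both colors of the list at `i + 1` would be open after `g i`, and the second one
continues greedily to another coloring with the same start. -/
lemma IsSeqColoring.mem_succ {m : ℕ} {l : ℕ → Finset ℕ} {g : ℕ → ℕ} (hg : IsSeqColoring m l g)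
    (hl : ∀ i, (l i).card = 2)
    (hu : ∀ g', IsSeqColoring m l g' → g' 0 = g 0 → ∀ i < m, g' i = g i) :
    ∀ i, i + 1 < m → g i ∈ l (i + 1) := by
  intro i hi
  obtain ⟨y, hy, hyg⟩ := exists_ne_of_card_eq_two (hl (i + 1)) (g (i + 1))
  by_cases hyi : y = g i
  · rwa [← hyi]
  exfalso
  obtain ⟨h, h0, hh⟩ := exists_isSeqColoring m (l := fun t => l (t + (i + 1))) (fun _ => hl _)
    (a := y) (by simpa using hy)
  have := hu (fun t => if t ≤ i then g t else h (t - (i + 1))) ⟨fun t ht => ?_, fun t ht => ?_⟩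
    (by simp) (i + 1) hi
  · simp only [show ¬ i + 1 ≤ i by omega, if_false, Nat.sub_self, h0] at this
    exact hyg this
  · by_cases hti : t ≤ i
    · simp only [hti, if_true]
      exact hg.mem t ht
    · simp only [hti, if_false]
      have := hh.mem (t - (i + 1)) (by omega)
      rwa [show t - (i + 1) + (i + 1) = t by omega] at this
  · rcases lt_trichotomy t i with h1 | rfl | h1
    · simp only [h1.le, show t + 1 ≤ i by omega, if_true]
      exact hg.ne t ht
    · simp only [le_refl, if_true, show ¬ t + 1 ≤ t by omega, if_false, Nat.sub_self, h0]
      exact Ne.symm hyi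
    · simp only [show ¬ t ≤ i by omega, show ¬ t + 1 ≤ i by omega, if_false]
      have := hh.ne (t - (i + 1)) (by omega)
      rwa [show t - (i + 1) + 1 = t + 1 - (i + 1) by omega] at this

lemma IsSeqColoring.reverse {m : ℕ} {l : ℕ → Finset ℕ} {g : ℕ → ℕ} (hg : IsSeqColoring m l g) :
    IsSeqColoring m (fun i => l (m - 1 - i)) (fun i => g (m - 1 - i)) where
  mem i hi := hg.mem _ (by omega)
  ne i hi := by
    have := hg.ne (m - 1 - (i + 1)) (by omega)
    rw [show m - 1 - (i + 1) + 1 = m - 1 - i by omega] at this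
    exact this.symm

lemma IsSeqColoring.of_reverse {m : ℕ} {l : ℕ → Finset ℕ} {g : ℕ → ℕ}
    (hg : IsSeqColoring m (fun i => l (m - 1 - i)) g) :
    IsSeqColoring m l (fun i => g (m - 1 - i)) where
  mem i hi := by
    have := hg.mem (m - 1 - i) (by omega)
    rwa [show m - 1 - (m - 1 - i) = i by omega] at this
  ne i hi := hg.reverse.ne i hi

/-- On an even cycle with two unequal adjacent lists, there are two colorings. -/
lemma exists_two_isSeqColoring {m : ℕ} (hm : 3 ≤ m) (he : Even m) {l : ℕ → Finset ℕ}
    (hl : ∀ i, (l i).card = 2) (hne : l 0 ≠ l (m - 1)) :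
    ∃ g g', IsSeqColoring m l g ∧ IsSeqColoring m l g' ∧ g (m - 1) ≠ g 0 ∧ g' (m - 1) ≠ g' 0 ∧
      ∃ i < m, g i ≠ g' i := by
  have hsub : ∀ i j, l i ≠ l j → ∃ a ∈ l i, a ∉ l j := by
    intro i j hij
    by_contra! hcon
    exact hij (Finset.eq_of_subset_of_card_le hcon (by rw [hl, hl]))
  -- Path colorings starting with `a`, or ending with `b`, close up around the cycle automatically.
  -- If only one coloring closes up, it starts with `a`, ends with `b`, and is forced in both
  -- directions.
  obtain ⟨a, ha, ha'⟩ := hsub _ _ hne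
  obtain ⟨b, hb, hb'⟩ := hsub _ _ hne.symm
  by_contra! hcon
  obtain ⟨g, hg0, hg⟩ := exists_isSeqColoring m hl ha
  obtain ⟨h, hh0, hh⟩ := exists_isSeqColoring m (l := fun i => l (m - 1 - i)) (fun _ => hl _) hb
  have va : ∀ g', IsSeqColoring m l g' → g' 0 = a → g' (m - 1) ≠ g' 0 := fun g' hg' h0 h1 =>
    ha' (by rw [← h0, ← h1]; exact hg'.mem _ (by omega))
  have vb : ∀ g', IsSeqColoring m l g' → g' (m - 1) = b → g' (m - 1) ≠ g' 0 := fun g' hg' h0 h1 =>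
    hb' (by rw [← h0, h1]; exact hg'.mem _ (by omega))
  have fwd := hg.mem_succ hl fun g' hg' h0 i hi =>
    hcon g' g hg' hg (va _ hg' (h0.trans hg0)) (va _ hg hg0) i hi
  have hgb : g (m - 1) = b := by
    rw [hcon g _ hg hh.of_reverse (va _ hg hg0) (vb _ hh.of_reverse (by simpa using hh0)) (m - 1)
      (by omega)]
    simpa using hh0
  have bwd := hg.reverse.mem_succ (fun _ => hl _) fun g' hg' h0 i hi => by
    have := hcon _ g hg'.of_reverse hg (vb _ hg'.of_reverse (by simpa [hgb] using h0))
      (va _ hg hg0) (m - 1 - i) (by omega)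
    simpa [show m - 1 - (m - 1 - i) = i by omega] using this
  replace bwd : ∀ i, i + 1 < m → g (i + 1) ∈ l i := fun i hi => by
    have := bwd (m - 1 - (i + 1)) (by omega)
    rwa [show m - 1 - (m - 1 - (i + 1)) = i + 1 by omega,
      show m - 1 - (m - 1 - (i + 1) + 1) = i by omega] at this
  -- The 2-list at `i + 1` contains the colors at `i`, `i + 1` and `i + 2`, and the middle color
  -- differs from the outer two.
  have alt : ∀ i, i + 2 < m → g i = g (i + 2) := by
    intro i hi
    have h1 := fwd i (by omega)
    have h2 := bwd (i + 1) (by omega)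
    have h3 := hg.mem (i + 1) (by omega)
    have h4 := hg.ne i (by omega)
    have h5 := hg.ne (i + 1) (by omega)
    obtain ⟨x, y, -, hxy⟩ := Finset.card_eq_two.1 (hl (i + 1))
    rw [hxy] at h1 h2 h3
    simp only [Finset.mem_insert, Finset.mem_singleton] at h1 h2 h3
    simp only [show i + 1 + 1 = i + 2 by omega] at h2 h5
    omega
  have odd : ∀ i, 2 * i + 1 < m → g (2 * i + 1) = g 1 := by
    intro i
    induction i with
    | zero => simp
    | succ i ih =>
      intro hi
      rw [← ih (by omega), alt (2 * i + 1) (by omega)]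
      ring_nf
  -- As `m` is even, `m - 1` is odd, so alternation carries the final color `b` back to position 1,
  -- and hence into `l 0`.
  obtain ⟨k, hk⟩ := he
  have h1 := odd (k - 1) (by omega)
  rw [show 2 * (k - 1) + 1 = m - 1 by omega, hgb] at h1
  apply hb'
  rw [h1]
  exact bwd 0 (by omega)

lemma IsPeriodicCycle.exists_mem_listColorings {m : ℕ} {f : ℕ → V} (hf : G.IsPeriodicCycle m f)
    (hs : Function.Surjective f) (hadj : ∀ x y, G.Adj x y → CycleAdj f x y) {L : V → Finset ℕ}
    {g : ℕ → ℕ} (hg : IsSeqColoring m (fun i => L (f i)) g) (hlast : g (m - 1) ≠ g 0) :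
    ∃ γ ∈ G.listColorings L, ∀ i < m, γ (f i) = g i := by
  have h3 := hf.three_le
  choose ind hind using fun v => hf.exists_lt (hs v)
  have hval : ∀ i, g (ind (f i)) = g (i % m) := by
    intro i
    congr 1
    exact hf.inj _ _ (hind _).1 (Nat.mod_lt _ (by omega)) ((hind _).2.trans (hf.apply_mod i).symm)
  have hsucc : ∀ i, g (i % m) ≠ g ((i + 1) % m) := by
    intro i
    have hi := Nat.mod_lt i (show 0 < m by omega)
    rw [Nat.add_mod, Nat.mod_eq_of_lt (show 1 < m by omega)]
    rcases Nat.lt_or_ge (i % m + 1) m with h | h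
    · rw [Nat.mod_eq_of_lt h]
      exact hg.ne _ h
    · rw [show i % m + 1 = m by omega, Nat.mod_self, show i % m = m - 1 by omega]
      exact hlast
  refine ⟨fun v => g (ind v), ⟨fun v => ?_, fun v w hvw => ?_⟩, fun i hi => ?_⟩
  · have := hg.mem (ind v) (hind v).1
    simpa only [(hind v).2] using this
  · obtain ⟨i, ⟨rfl, rfl⟩ | ⟨rfl, rfl⟩⟩ := hadj v w hvw
    · simp only [hval]
      exact hsucc i
    · simp only [hval]
      exact (hsucc i).symm
  · simp only [hval, Nat.mod_eq_of_lt hi]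

lemma CycleAdj.shift {m : ℕ} {f : ℕ → V} (hf : G.IsPeriodicCycle m f) (k : ℕ) {x y : V}
    (h : CycleAdj f x y) : CycleAdj (fun i => f (i + k)) x y := by
  have h3 := hf.three_le
  have hk : k ≤ k * m := Nat.le_mul_of_pos_right k (by omega)
  obtain ⟨i, h⟩ := h
  have h1 : f (i + k * m - k + k) = f i := by
    rw [show i + k * m - k + k = i + k * m by omega, hf.eq_iff]
    simp
  have h2 : f (i + k * m - k + 1 + k) = f (i + 1) := by
    rw [show i + k * m - k + 1 + k = i + 1 + k * m by omega, hf.eq_iff]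
    simp
  refine ⟨i + k * m - k, ?_⟩
  simp only [h1, h2]
  exact h

/-- If all lists are equal, the two alternating colorings are different. Otherwise the cycle is
rotated so that two unequal consecutive lists meet at the seam, where `exists_two_isSeqColoring`
applies. -/
lemma IsPeriodicCycle.not_hasRigidLists {m : ℕ} {f : ℕ → V} (hf : G.IsPeriodicCycle m f)
    (hs : Function.Surjective f) (hadj : ∀ x y, G.Adj x y → CycleAdj f x y) (he : Even m) :
    ¬ G.HasRigidLists := by
  rintro ⟨L, hL, hsub⟩
  have h3 := hf.three_le
  by_cases hall : ∃ i, L (f (i + 1)) ≠ L (f i)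
  · obtain ⟨i, hi⟩ := hall
    have hf' := hf.shift (i + 1)
    obtain ⟨g, g', hg, hg', h1, h2, t, ht, hne⟩ := exists_two_isSeqColoring h3 he
      (l := fun j => L (f (j + (i + 1)))) (fun _ => hL _) (by
        rwa [zero_add, show m - 1 + (i + 1) = i + m by omega, hf.periodic])
    have hs' : Function.Surjective (fun j => f (j + (i + 1))) := by
      rw [← Set.range_eq_univ, hf.mem_range_shift, hs.range_eq]
    have hadj' := fun x y h => (hadj x y h).shift hf (i + 1)
    obtain ⟨γ, hγ, e1⟩ := hf'.exists_mem_listColorings hs' hadj' hg h1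
    obtain ⟨γ', hγ', e2⟩ := hf'.exists_mem_listColorings hs' hadj' hg' h2
    rw [← e1 t ht, ← e2 t ht, hsub hγ hγ'] at hne
    exact hne rfl
  · push Not at hall
    have hconst : ∀ i, L (f i) = L (f 0) := by
      intro i
      induction i with
      | zero => rfl
      | succ i ih => rw [hall, ih]
    obtain ⟨p, q, hpq, hLpq⟩ := Finset.card_eq_two.1 (hL (f 0))
    have key : ∀ p q, p ∈ L (f 0) → q ∈ L (f 0) → p ≠ q →
        ∃ γ ∈ G.listColorings L, γ (f 0) = p := by
      intro p q hp hq hpq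
      have hseq : IsSeqColoring m (fun i => L (f i)) (fun i => if Even i then p else q) := by
        refine ⟨fun i _ => ?_, fun i _ => ?_⟩
        · simp only [hconst i]
          split_ifs <;> assumption
        · by_cases hi : Even i <;> simp [Nat.even_add_one, hi, hpq, hpq.symm]
      have hodd : ¬ Even (m - 1) := by
        rw [Nat.even_sub (by omega)]
        simp [he]
      obtain ⟨γ, hγ, h⟩ := hf.exists_mem_listColorings hs hadj hseq (by simp [hodd, hpq.symm])
      exact ⟨γ, hγ, by rw [h 0 (by omega)]; simp⟩
    obtain ⟨γ, hγ, e1⟩ := key p q (by simp [hLpq]) (by simp [hLpq]) hpq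
    obtain ⟨γ', hγ', e2⟩ := key q p (by simp [hLpq]) (by simp [hLpq]) hpq.symm
    rw [← e1, ← e2, hsub hγ hγ'] at hpq
    exact hpq rfl

/-- The vertices of a cycle graph in their order. -/
lemma isPeriodicCycle_cycleGraph {m : ℕ} (hm : 3 ≤ m) :
    (cycleGraph m).IsPeriodicCycle m (fun i => ⟨i % m, Nat.mod_lt _ (by omega)⟩) := by
  refine ⟨hm, fun i => ?_, fun i => by simp, fun i j hi hj hij => ?_⟩
  · rw [cycleGraph_adj']
    right
    rw [Fin.val_sub]
    simp only
    have hi := Nat.mod_lt i (show 0 < m by omega)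
    rw [Nat.add_mod i 1, Nat.mod_eq_of_lt (show 1 < m by omega), Nat.add_mod_mod,
      show m - i % m + (i % m + 1) = 1 + m by omega, Nat.add_mod_right, Nat.mod_eq_of_lt (by omega)]
  · simpa [Nat.mod_eq_of_lt hi, Nat.mod_eq_of_lt hj] using hij

lemma cycleAdj_of_cycleGraph_adj {m : ℕ} (hm : 3 ≤ m) {x y : Fin m} (h : (cycleGraph m).Adj x y) :
    CycleAdj (fun i : ℕ => (⟨i % m, Nat.mod_lt _ (by omega)⟩ : Fin m)) x y := by
  have key : ∀ x y : Fin m, (y - x).val = 1 → y.val = (x.val + 1) % m := by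
    intro x y h
    rw [Fin.val_sub] at h
    have hx := x.2
    have h1 : (x.val + 1) % m = (x.val + (m - x.val + y.val)) % m := by
      rw [Nat.add_mod, ← Nat.mod_eq_of_lt (show 1 < m by omega), ← h]
      simp
    rw [h1, show x.val + (m - x.val + y.val) = y.val + m by omega, Nat.add_mod_right,
      Nat.mod_eq_of_lt y.2]
  rw [cycleGraph_adj'] at h
  rcases h with h | h
  · exact ⟨y, .inr ⟨Fin.ext (Nat.mod_eq_of_lt y.2).symm, Fin.ext (key _ _ h)⟩⟩
  · exact ⟨x, .inl ⟨Fin.ext (Nat.mod_eq_of_lt x.2).symm, Fin.ext (key _ _ h)⟩⟩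

lemma not_hasRigidLists_cycleGraph {m : ℕ} (hm : 3 ≤ m) (he : Even m) :
    ¬ (cycleGraph m).HasRigidLists :=
  (isPeriodicCycle_cycleGraph hm).not_hasRigidLists
    (fun x => ⟨x, Fin.ext (Nat.mod_eq_of_lt x.2)⟩) (fun _ _ => cycleAdj_of_cycleGraph_adj hm) he

lemma IsCycleGraph.not_hasRigidLists {c : V → ℕ} (hc : G.IsTwoColoring c) (h : G.IsCycleGraph) :
    ¬ G.HasRigidLists := by
  obtain ⟨m, hm, ⟨e⟩⟩ := h
  have hc' : (cycleGraph m).IsTwoColoring (fun x => c (e.symm x)) :=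
    ⟨fun x => hc.mem _, fun x y hxy => hc.ne _ _ (e.symm.map_adj_iff.2 hxy)⟩
  exact fun hr => not_hasRigidLists_cycleGraph hm ((isPeriodicCycle_cycleGraph hm).even hc')
    (e.hasRigidLists hr)

lemma IsK23.not_hasRigidLists (h : G.IsK23) : ¬ G.HasRigidLists := by
  obtain ⟨e⟩ := h
  exact fun hr => not_hasRigidLists_completeBipartiteGraph (e.hasRigidLists hr)

/-! ### Cycles in leafless connected bipartite graphs -/

lemma IsTwoColoring.even_of_isCycle {c : V → ℕ} (hc : G.IsTwoColoring c) {u : V} {p : G.Walk u u}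
    (hp : p.IsCycle) : Even p.length := by
  obtain ⟨f, hf, -⟩ := hp.exists_isPeriodicCycle
  exact hf.even hc

/-- A 2-coloring of a spanning tree works: an edge with equally colored ends is off the tree, and
the tree path between its ends has even length, so together they form an odd cycle. -/
lemma AllCyclesEven.exists_isTwoColoring (hG : G.Connected) (h : G.AllCyclesEven) :
    ∃ c, G.IsTwoColoring c := by
  obtain ⟨T, hTG, hT⟩ := hG.exists_isTree_le
  obtain ⟨C⟩ := hT.colorable_two
  have hfin : ∀ a : Fin 2, (a : ℕ) + 1 = 1 ∨ (a : ℕ) + 1 = 2 := by decide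
  refine ⟨fun v => (C v : ℕ) + 1, fun v => hfin _, fun v w hvw he => ?_⟩
  by_cases hT' : T.Adj v w
  · exact C.valid hT' (Fin.ext (by simpa using he))
  obtain ⟨p, hp⟩ := hT.connected.exists_isPath w v
  have hlen := IsTwoColoring.eq_iff_even (c := fun v => (C v : ℕ) + 1) p.getVert p.length
    (fun i _ => hfin _) (fun i hi hi' => C.valid (p.adj_getVert_succ hi)
      (Fin.ext (by simpa using hi')))
  rw [Walk.getVert_zero, Walk.getVert_length] at hlen
  have hcyc : (Walk.cons hvw (p.mapLe hTG)).IsCycle := by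
    rw [Walk.cons_isCycle_iff]
    refine ⟨hp.mapLe hTG, fun hmem => hT' ?_⟩
    rw [Walk.edges_mapLe_eq_edges] at hmem
    exact p.adj_of_mem_edges hmem
  have := h _ _ hcyc
  rw [Walk.length_cons, Walk.length_map, Nat.even_add_one] at this
  exact this (hlen.1 he)

lemma IsPruning.connected {H : G.Subgraph} (hH : G.IsPruning H) (hG : G.Connected) :
    H.coe.Connected := by
  classical
  induction hH with
  | top => exact (Subgraph.topIso.connected_iff).2 hG
  | delete H v _ hv hdeg ih =>
    obtain ⟨w, hw⟩ := Set.ncard_eq_one.1 hdeg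
    have hnb : ∀ x, H.Adj v x ↔ x = w := fun x => by
      rw [← Subgraph.mem_neighborSet, hw, Set.mem_singleton_iff]
    have huniq : ∃! x, H.coe.Adj ⟨v, hv⟩ x := by
      refine ⟨⟨w, ((hnb w).2 rfl).snd_mem⟩, (hnb w).2 rfl, fun y hy => Subtype.ext ((hnb _).1 hy)⟩
    have : Fintype (H.coe.neighborSet ⟨v, hv⟩) :=
      Set.Finite.fintype (Set.Subsingleton.finite fun a ha b hb => huniq.unique ha hb)
    have hconn := ih.induce_compl_singleton_of_degree_eq_one
      (degree_eq_one_iff_existsUnique_adj.2 huniq)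
    refine hconn.map (H := (H.deleteVerts {v}).coe)
      ⟨fun x => ⟨x.1.1, x.1.2, fun h => x.2 (Subtype.ext h)⟩, fun {x y} hxy => ?_⟩ ?_
    · rw [Subgraph.coe_adj, Subgraph.deleteVerts_adj]
      exact ⟨x.1.2, fun h => x.2 (Subtype.ext h), y.1.2, fun h => y.2 (Subtype.ext h), hxy⟩
    · rintro ⟨x, hx, hx'⟩
      exact ⟨⟨⟨x, hx⟩, fun h => hx' (congrArg Subtype.val h)⟩, rfl⟩

lemma Subgraph.map_injective_of_injective {W : Type*} {K : SimpleGraph W} {f : K →g G}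
    (hf : Function.Injective f) : Function.Injective (Subgraph.map f) := by
  intro S T h
  refine Subgraph.ext (hf.image_injective (congrArg Subgraph.verts h)) ?_
  ext x y
  have key : ∀ S : K.Subgraph, (S.map f).Adj (f x) (f y) ↔ S.Adj x y := fun S => by
    simp [Subgraph.map_adj, Relation.map_apply, hf.eq_iff]
  rw [← key S, h, key T]

lemma HasTwoCyclesUnionNotK23.of_coe {H : G.Subgraph} (h : H.coe.HasTwoCyclesUnionNotK23) :
    G.HasTwoCyclesUnionNotK23 := by
  obtain ⟨u, v, p, q, hp, hq, hne, hK⟩ := h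
  have hinj : Function.Injective H.hom := Subtype.val_injective
  let f : Copy H.coe G := ⟨H.hom, hinj⟩
  refine ⟨_, _, p.map H.hom, q.map H.hom, hp.map hinj, hq.map hinj, ?_, ?_⟩
  · rw [Walk.toSubgraph_map, Walk.toSubgraph_map]
    exact fun h => hne (Subgraph.map_injective_of_injective hinj h)
  · rw [Walk.toSubgraph_map, Walk.toSubgraph_map, ← Subgraph.map_sup]
    rintro ⟨e⟩
    exact hK ⟨(f.isoSubgraphMap _).trans e⟩

/-- A connected graph without leaves, except possibly one, has a cycle. -/
lemma Connected.exists_isCycle [Finite V] [Nontrivial V] (hG : G.Connected) (b : V)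
    (h : ∀ v, v ≠ b → (G.neighborSet v).ncard ≠ 1) :
    ∃ (u : V) (p : G.Walk u u), p.IsCycle := by
  classical
  by_contra! hcon
  have := Fintype.ofFinite V
  -- A nontrivial tree has two leaves, and one of them is not `b`.
  obtain ⟨u, v, huv, hu, hv⟩ := (IsTree.mk hG fun u p => hcon u p).exists_ne_and_degree_eq_one
  have key : ∀ v, G.degree v = 1 → (G.neighborSet v).ncard = 1 := fun v hv => by
    rw [Set.ncard_eq_toFinset_card', ← hv, degree, neighborFinset]
  by_cases hub : u = b
  · exact h v (fun hvb => huv (hub.trans hvb.symm)) (key v hv)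
  · exact h u hub (key u hu)

/-- If the edge is not a bridge, a cycle passes through it. If it is, the component of `b` after its
removal has no leaf except possibly `b`, the only vertex there to lose a neighbor, and so contains a
cycle; `p` stays in the component of `a`. -/
lemma exists_isCycle_of_adj [Finite V] (hdeg : ∀ v, (G.neighborSet v).ncard ≠ 1) {u a b : V}
    {p : G.Walk u u} (ha : a ∈ p.support) (hab : G.Adj a b)
    (he : s(a, b) ∉ p.edges) :
    (∃ (w : V) (q : G.Walk w w), q.IsCycle ∧ s(a, b) ∈ q.edges) ∨
      ∃ (w : V) (q : G.Walk w w), q.IsCycle ∧ ∀ x ∈ q.support, x ∉ p.support := by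
  classical
  set D := G.deleteEdges {s(a, b)} with hD
  by_cases hreach : D.Reachable a b
  · exact .inl (adj_and_reachable_delete_edges_iff_exists_cycle.1 ⟨hab, hreach⟩)
  right
  have hDadj : ∀ x y, D.Adj x y ↔ G.Adj x y ∧ s(x, y) ≠ s(a, b) := fun x y => by
    simp [hD, deleteEdges_adj]
  set K := D.connectedComponentMk b with hK
  have hmem : ∀ x, x ∈ K.supp ↔ D.Reachable x b := fun x => by
    rw [ConnectedComponent.mem_supp_iff, ConnectedComponent.eq]
  have hb : b ∈ K.supp := (hmem b).2 (Reachable.refl _)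
  obtain ⟨t, hbt, hta⟩ : ∃ t, G.Adj b t ∧ t ≠ a := by
    by_contra! hcon
    exact hdeg b (Set.ncard_eq_one.2 ⟨a, Set.ext fun x => ⟨hcon x, fun hx => hx ▸ hab.symm⟩⟩)
  have hDbt : D.Adj b t := (hDadj _ _).2 ⟨hbt, fun h => by
    rw [Sym2.eq_iff] at h
    rcases h with ⟨h1, -⟩ | ⟨-, h1⟩
    · exact hab.ne h1.symm
    · exact hta h1⟩
  have : Nontrivial K := ⟨⟨b, hb⟩, ⟨t, (hmem t).2 hDbt.symm.reachable⟩,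
    fun h => hbt.ne (congrArg Subtype.val h)⟩
  obtain ⟨w, q, hq⟩ := K.connected_toSimpleGraph.exists_isCycle ⟨b, hb⟩ (by
    rintro ⟨x, hx⟩ hxb h1
    have hxb' : x ≠ b := fun h => hxb (Subtype.ext h)
    have hxa : x ≠ a := fun h => hreach (h ▸ (hmem x).1 hx)
    apply hdeg x
    rw [← h1, ← Set.ncard_image_of_injective _ Subtype.val_injective]
    congr 1
    ext y
    rw [mem_neighborSet, Set.mem_image]
    constructor
    · intro hxy
      have hDxy : D.Adj x y := (hDadj _ _).2 ⟨hxy, fun h => by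
        rw [Sym2.eq_iff] at h
        rcases h with ⟨h1, -⟩ | ⟨h1, -⟩
        · exact hxa h1
        · exact hxb' h1⟩
      have hy : y ∈ K.supp := (hmem y).2 (hDxy.symm.reachable.trans ((hmem x).1 hx))
      exact ⟨⟨y, hy⟩, (K.toSimpleGraph_adj hx hy).2 hDxy, rfl⟩
    · rintro ⟨⟨y', hy'⟩, h2, rfl⟩
      exact ((hDadj _ _).1 ((K.toSimpleGraph_adj hx hy').1 h2)).1)
  have hinj : Function.Injective K.toSimpleGraph_hom := Subtype.val_injective
  refine ⟨_, (q.map K.toSimpleGraph_hom).mapLe (deleteEdges_le _), (hq.map hinj).mapLe _, ?_⟩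
  intro x hx hxp
  rw [Walk.support_mapLe_eq_support, Walk.support_map, List.mem_map] at hx
  obtain ⟨⟨y, hy⟩, -, rfl⟩ := hx
  have hpe : ∀ e ∈ p.edges, e ∉ ({s(a, b)} : Set (Sym2 V)) := fun e hep h => by
    rw [Set.mem_singleton_iff] at h
    exact he (h ▸ hep)
  let p' := p.toDeleteEdges {s(a, b)} hpe
  have hp' : p'.support = p.support := Walk.support_transfer _ _
  have hya : D.Reachable a y := by
    have h1 : D.Reachable u a := ⟨p'.takeUntil a (hp' ▸ ha)⟩
    have h2 : D.Reachable u y := ⟨p'.takeUntil y (hp' ▸ hxp)⟩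
    exact h1.symm.trans h2
  exact hreach (hya.trans ((hmem y).1 hy))

/-- A connected graph that is not a cycle has, for every cycle, an edge off it at one of its
vertices. -/
lemma Connected.exists_adj_notMem_edges (hG : G.Connected) (hcy : ¬ G.IsCycleGraph) {u : V}
    {p : G.Walk u u} (hp : p.IsCycle) : ∃ a b, a ∈ p.support ∧ G.Adj a b ∧ s(a, b) ∉ p.edges := by
  by_contra! hcon
  have hsupp : ∀ v, v ∈ p.support := by
    intro v
    by_contra hv
    obtain ⟨q⟩ := hG.preconnected u v
    obtain ⟨d, -, h1, h2⟩ := q.exists_boundary_dart {x | x ∈ p.support} p.start_mem_support hv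
    exact h2 (p.snd_mem_support_of_mem_edges (hcon _ _ h1 d.adj))
  obtain ⟨f, hf, hfs, hfa⟩ := hp.exists_isPeriodicCycle
  have hm := hf.three_le
  have hbij : Function.Bijective (fun i : Fin p.length => f i) := by
    constructor
    · intro i j hij
      exact Fin.ext (hf.inj _ _ i.2 j.2 hij)
    · intro v
      obtain ⟨i, hi, rfl⟩ := hf.exists_lt ((hfs v).1 (hsupp v))
      exact ⟨⟨i, hi⟩, rfl⟩
  refine hcy ⟨p.length, hm, ⟨Iso.symm ⟨Equiv.ofBijective _ hbij, ?_⟩⟩⟩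
  intro x y
  simp only [Equiv.ofBijective_apply]
  constructor
  · intro hxy
    have h1 := (hfa _ _).1 (Walk.adj_toSubgraph_iff_mem_edges.2 (hcon _ _ (hsupp _) hxy))
    have hlt : ∀ i, i % p.length < p.length := fun i => Nat.mod_lt _ (by omega)
    have h2 := fun i => (isPeriodicCycle_cycleGraph hm).adj i
    have h3 : ∀ (x : Fin p.length) i, f x = f i → x = ⟨i % p.length, hlt i⟩ := fun x i h =>
      Fin.ext (hf.inj _ _ x.2 (hlt i) (h.trans (hf.apply_mod i).symm))
    obtain ⟨i, ⟨e1, e2⟩ | ⟨e1, e2⟩⟩ := h1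
    · rw [h3 x _ e1, h3 y _ e2]
      exact h2 i
    · rw [h3 x _ e2, h3 y _ e1]
      exact (h2 i).symm
  · intro hxy
    obtain ⟨i, ⟨rfl, rfl⟩ | ⟨rfl, rfl⟩⟩ := cycleAdj_of_cycleGraph_adj hm hxy
    · simp only [hf.apply_mod]
      exact hf.adj i
    · simp only [hf.apply_mod]
      exact (hf.adj i).symm

lemma Walk.IsCycle.four_le_ncard {c : V → ℕ} (hc : G.IsTwoColoring c) {u : V} {p : G.Walk u u}
    (hp : p.IsCycle) : 4 ≤ {x | x ∈ p.support}.ncard := by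
  obtain ⟨f, hf, hfs, -⟩ := hp.exists_isPeriodicCycle
  have h3 := hf.three_le
  obtain ⟨k, hk⟩ := hf.even hc
  have : {x | x ∈ p.support} = f '' Set.Iio p.length := by
    ext x
    rw [Set.mem_ofPred_eq, hfs]
    constructor
    · intro hx
      obtain ⟨i, hi, rfl⟩ := hf.exists_lt hx
      exact ⟨i, hi, rfl⟩
    · rintro ⟨i, -, rfl⟩
      exact ⟨i, rfl⟩
  have hinj : Set.InjOn f (Set.Iio p.length) := fun i hi j hj h => hf.inj i j hi hj h
  rw [this, hinj.ncard_image, Set.ncard_eq_toFinset_card']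
  simp
  omega

lemma exists_isCycle_quadrilateral {u s v t : V} (h1 : G.Adj u s) (h2 : G.Adj s v)
    (h3 : G.Adj v t) (h4 : G.Adj t u) (huv : u ≠ v) (hst : s ≠ t) :
    ∃ p : G.Walk u u, p.IsCycle ∧ ∀ w, w ∈ p.support ↔ w ∈ ({u, s, v, t} : Set V) := by
  refine ⟨.cons h1 (.cons h2 (.cons h3 (.cons h4 .nil))), ?_, fun w => ?_⟩
  · have := h1.ne
    have := h2.ne
    have := h3.ne
    have := h4.ne
    rw [Walk.cons_isCycle_iff, Walk.isPath_def]
    simp only [Walk.support_cons, Walk.support_nil, Walk.edges_cons, Walk.edges_nil]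
    simp only [List.nodup_cons, List.mem_cons, List.not_mem_nil, or_false, not_or, Sym2.eq_iff,
      List.nodup_nil]
    grind
  · simp only [Walk.support_cons, Walk.support_nil, List.mem_cons, List.not_mem_nil, or_false,
      Set.mem_insert_iff, Set.mem_singleton_iff]
    tauto

lemma IsK23.ncard_verts {S : G.Subgraph} (h : S.coe.IsK23) : S.verts.ncard = 5 := by
  obtain ⟨e⟩ := h
  rw [← Nat.card_coe_set_eq, Nat.card_congr e.toEquiv]
  simp

/-- A connected bipartite graph without leaves has two cycles whose union is not `K_{2,3}`, unless
it is a single vertex, a cycle or `K_{2,3}`. -/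
lemma Connected.hasTwoCyclesUnionNotK23 [Finite V] (hG : G.Connected) {c : V → ℕ}
    (hc : G.IsTwoColoring c) (hdeg : ∀ v, (G.neighborSet v).ncard ≠ 1)
    (hsv : ¬ G.IsSingleVertex) (hcy : ¬ G.IsCycleGraph) (hK : ¬ G.IsK23) :
    G.HasTwoCyclesUnionNotK23 := by
  classical
  by_contra hcon
  have union : ∀ {u v : V} {p : G.Walk u u} {q : G.Walk v v}, p.IsCycle → q.IsCycle →
      ∀ e ∈ q.edges, e ∉ p.edges → (p.toSubgraph ⊔ q.toSubgraph).coe.IsK23 := by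
    intro u v p q hp hq e heq hep
    by_contra hnot
    refine hcon ⟨u, v, p, q, hp, hq, fun h => hep ?_, hnot⟩
    rwa [← Walk.mem_edges_toSubgraph, h, Walk.mem_edges_toSubgraph]
  have five : ∀ {u v : V} {p : G.Walk u u} {q : G.Walk v v}, p.IsCycle → q.IsCycle →
      ∀ e ∈ q.edges, e ∉ p.edges → ({x | x ∈ p.support} ∪ {x | x ∈ q.support}).ncard = 5 := by
    intro u v p q hp hq e heq hep
    have := (union hp hq e heq hep).ncard_verts
    rwa [Subgraph.verts_sup, Walk.verts_toSubgraph, Walk.verts_toSubgraph] at this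
  -- Disjoint cycles have at least eight vertices together, against the five of K_{2,3}.
  have disj : ∀ {u v : V} {p : G.Walk u u} {q : G.Walk v v}, p.IsCycle → q.IsCycle →
      ¬ ∀ x ∈ q.support, x ∉ p.support := by
    intro u v p q hp hq hd
    have hlt : 0 < q.length := by have := hq.three_le_length; omega
    have h5 := five hp hq s(q.getVert 0, q.getVert 1)
      (q.mk_mem_edges_iff_exists.2 ⟨0, by simp; omega⟩)
      (fun h => hd _ (q.getVert_mem_support 0) (p.fst_mem_support_of_mem_edges h))
    have hdisj : Disjoint {x | x ∈ p.support} {x | x ∈ q.support} := Set.disjoint_right.2 hd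
    rw [Set.ncard_union_eq hdisj] at h5
    have := hp.four_le_ncard hc
    have := hq.four_le_ncard hc
    omega
  obtain ⟨b₀⟩ := hG.nonempty
  have : Nontrivial V := by
    by_contra hnt
    rw [not_nontrivial_iff_subsingleton] at hnt
    exact hsv ⟨b₀, fun w => Subsingleton.elim _ _⟩
  obtain ⟨_, p, hp⟩ := hG.exists_isCycle b₀ fun v _ => hdeg v
  obtain ⟨a, b, ha, hab, he⟩ := hG.exists_adj_notMem_edges hcy hp
  obtain ⟨w, q, hq, hqe⟩ | ⟨w, q, hq, hd⟩ := exists_isCycle_of_adj hdeg ha hab he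
  swap
  · exact disj hp hq hd
  obtain ⟨e⟩ := union hp hq _ hqe he
  set S := p.toSubgraph ⊔ q.toSubgraph
  have hSadj : ∀ i j, G.Adj (e.symm (.inl i)) (e.symm (.inr j)) := fun i j =>
    S.adj_sub (e.symm.map_adj_iff.2 (by simp : (completeBipartiteGraph _ _).Adj (.inl i) (.inr j)))
  have hSinj : ∀ i j, i ≠ j → (e.symm i : V) ≠ e.symm j := fun i j hij h =>
    hij (e.symm.injective (Subtype.ext h))
  obtain ⟨u, v, x, y, z, hd, hx, hy, hz⟩ : ∃ u v x y z : V, [u, v, x, y, z].Nodup ∧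
      (G.Adj u x ∧ G.Adj v x) ∧ (G.Adj u y ∧ G.Adj v y) ∧ (G.Adj u z ∧ G.Adj v z) := by
    refine ⟨e.symm (.inl 0), e.symm (.inl 1), e.symm (.inr 0), e.symm (.inr 1), e.symm (.inr 2), ?_,
      ⟨hSadj _ _, hSadj _ _⟩, ⟨hSadj _ _, hSadj _ _⟩, ⟨hSadj _ _, hSadj _ _⟩⟩
    simp only [List.nodup_cons, List.mem_cons, List.not_mem_nil, or_false, not_or, List.nodup_nil]
    refine ⟨⟨?_, ?_, ?_, ?_⟩, ⟨?_, ?_, ?_⟩, ⟨?_, ?_⟩, ?_, not_false, trivial⟩ <;>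
      exact hSinj _ _ (by decide)
  -- If the K_{2,3} spans `G`, bipartiteness leaves no room for further edges.
  obtain ⟨w', hw'⟩ : ∃ w, w ∉ [u, v, x, y, z] := by
    by_contra! hall
    exact hK (hc.isK23 hd hall hx hy hz)
  obtain ⟨r⟩ := hG.preconnected u w'
  obtain ⟨⟨⟨a', b'⟩, hab'⟩, -, ha', hb'⟩ :=
    r.exists_boundary_dart {w | w ∈ [u, v, x, y, z]} (by simp) hw'
  simp only [Set.mem_ofPred_eq, List.mem_cons, List.not_mem_nil, or_false, not_or] at ha' hb' hab'
  simp only [List.nodup_cons, List.mem_cons, List.not_mem_nil, or_false, not_or] at hd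
  obtain ⟨pxy, hxy, hxys⟩ := exists_isCycle_quadrilateral hx.1 hx.2.symm hy.2 hy.1.symm
    (by tauto) (by tauto)
  obtain ⟨pxz, hxz, hxzs⟩ := exists_isCycle_quadrilateral hx.1 hx.2.symm hz.2 hz.1.symm
    (by tauto) (by tauto)
  obtain ⟨pyz, hyz, hyzs⟩ := exists_isCycle_quadrilateral hy.1 hy.2.symm hz.2 hz.1.symm
    (by tauto) (by tauto)
  have hb : ∀ {s t : V} {p : G.Walk u u}, (∀ w, w ∈ p.support ↔ w ∈ ({u, s, v, t} : Set V)) →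
      s ∈ [x, y, z] → t ∈ [x, y, z] → b' ∉ p.support := by
    intro s t p hp hs ht hbp
    rw [hp] at hbp
    simp only [Set.mem_insert_iff, Set.mem_singleton_iff, List.mem_cons, List.not_mem_nil,
      or_false] at hbp hs ht
    grind
  -- An edge leaving the K_{2,3} starts on one of its quadrilaterals and lies on a cycle, because
  -- the alternative would be a cycle disjoint from that quadrilateral.
  obtain ⟨w₁, r, hr, hre⟩ : ∃ (w : V) (r : G.Walk w w), r.IsCycle ∧ s(a', b') ∈ r.edges := by
    have key : ∀ {p : G.Walk u u}, p.IsCycle → a' ∈ p.support → b' ∉ p.support →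
        ∃ (w : V) (r : G.Walk w w), r.IsCycle ∧ s(a', b') ∈ r.edges := by
      intro p hp hap hbp
      refine (exists_isCycle_of_adj hdeg hap hab' fun h =>
        hbp (p.snd_mem_support_of_mem_edges h)).resolve_right ?_
      rintro ⟨w, q, hq, hdq⟩
      exact disj hp hq hdq
    by_cases haz : a' = z
    · exact key hxz ((hxzs _).2 (by simp [haz])) (hb hxzs (by simp) (by simp))
    · refine key hxy ((hxys _).2 ?_) (hb hxys (by simp) (by simp))
      simp only [Set.mem_insert_iff, Set.mem_singleton_iff]
      tauto
  have hbr : b' ∈ r.support := r.snd_mem_support_of_mem_edges hre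
  have hsub : ∀ {p : G.Walk u u}, p.IsCycle → b' ∉ p.support → ∀ w ∈ r.support,
      w = b' ∨ w ∈ p.support := by
    intro p hp hbp w hw
    have h5 := five hp hr _ hre fun h => hbp (p.snd_mem_support_of_mem_edges h)
    have h6 : (insert b' {x | x ∈ p.support}).ncard = _ :=
      Set.ncard_insert_of_notMem (show b' ∉ {x | x ∈ p.support} from hbp)
    have h4 := hp.four_le_ncard hc
    have hle : insert b' {x | x ∈ p.support} ⊆ {x | x ∈ p.support} ∪ {x | x ∈ r.support} :=
      Set.insert_subset (.inr hbr) Set.subset_union_left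
    have := Set.eq_of_subset_of_ncard_le hle (by omega)
    have hw' : w ∈ {x | x ∈ p.support} ∪ {x | x ∈ r.support} := .inr hw
    rw [← this] at hw'
    exact hw'
  -- Counting five vertices confines `r` to each quadrilateral together with `b'`. The three
  -- quadrilaterals share only `u` and `v`, so `r` would have at most three vertices.
  have hsmall : {w | w ∈ r.support} ⊆ ({u, v, b'} : Set V) := by
    intro w hw
    have h1 := hsub hxy (hb hxys (by simp) (by simp)) w hw
    have h2 := hsub hxz (hb hxzs (by simp) (by simp)) w hw
    have h3 := hsub hyz (hb hyzs (by simp) (by simp)) w hw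
    rw [hxys] at h1
    rw [hxzs] at h2
    rw [hyzs] at h3
    simp only [Set.mem_insert_iff, Set.mem_singleton_iff] at h1 h2 h3 ⊢
    grind
  have h4 := hr.four_le_ncard hc
  have h3 := Set.ncard_le_ncard hsmall (Set.toFinite _)
  have h2 : ({u, v, b'} : Set V).ncard ≤ 3 := by
    refine (Set.ncard_insert_le _ _).trans ?_
    have := Set.ncard_insert_le v {b'}
    rw [Set.ncard_singleton] at this
    omega
  omega

lemma IsCore.ncard_neighborSet_ne_one {C : G.Subgraph} (hC : G.IsCore C) (v : C.verts) :
    (C.coe.neighborSet v).ncard ≠ 1 := by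
  have := hC.2 v v.2
  rwa [← Set.ncard_image_of_injective _ Subtype.val_injective,
    show Subtype.val '' C.coe.neighborSet v = C.neighborSet v from ?_]
  ext x
  constructor
  · rintro ⟨y, hy, rfl⟩
    exact hy
  · intro hx
    exact ⟨⟨x, Subgraph.Adj.snd_mem hx⟩, hx, rfl⟩

end SimpleGraph

/-! ### The characterization -/

open SimpleGraph

theorem mainTheorem2 {V : Type*} [Finite V] (G : SimpleGraph V) (hG : G.Connected) :
    (∀ C : G.Subgraph, G.IsCore C →
      (G.IsMonophilic 2 ↔
        C.coe.IsSingleVertex ∨ C.coe.IsCycleGraph ∨ C.coe.IsK23 ∨ C.coe.HasOddCycle)) ∧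
    (¬ G.IsMonophilic 2 ↔ G.AllCyclesEven ∧ G.HasTwoCyclesUnionNotK23) := by
  have good : ∀ C : G.Subgraph, G.IsCore C → C.coe.IsSingleVertex ∨ C.coe.IsCycleGraph ∨
      C.coe.IsK23 ∨ C.coe.HasOddCycle → G.IsMonophilic 2 := by
    intro C hC h
    rw [isMonophilic_two_iff hG]
    intro c hc hr
    have hr' := hC.1.hasRigidLists_coe hr
    rcases h with h | h | h | ⟨v, p, hp, hodd⟩
    · exact h.not_hasRigidLists hr'
    · exact h.not_hasRigidLists (hc.coe C) hr'
    · exact h.not_hasRigidLists hr'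
    · exact Nat.not_even_iff_odd.2 hodd ((hc.coe C).even_of_isCycle hp)
  have bad : ∀ C : G.Subgraph, G.IsCore C → ¬ (C.coe.IsSingleVertex ∨ C.coe.IsCycleGraph ∨
      C.coe.IsK23 ∨ C.coe.HasOddCycle) → G.AllCyclesEven ∧ G.HasTwoCyclesUnionNotK23 := by
    intro C hC h
    simp only [not_or] at h
    obtain ⟨h1, h2, h3, h4⟩ := h
    have hconn := hC.1.connected hG
    have heven : C.coe.AllCyclesEven := fun v p hp => by
      by_contra hodd
      exact h4 ⟨v, p, hp, Nat.not_even_iff_odd.1 hodd⟩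
    obtain ⟨c, hc⟩ := heven.exists_isTwoColoring hconn
    obtain ⟨c', hc'⟩ := hC.1.exists_isTwoColoring ⟨c, hc⟩
    exact ⟨fun v p hp => hc'.even_of_isCycle hp,
      (hconn.hasTwoCyclesUnionNotK23 hc hC.ncard_neighborSet_ne_one h1 h2 h3).of_coe⟩
  have notMono : G.AllCyclesEven ∧ G.HasTwoCyclesUnionNotK23 → ¬ G.IsMonophilic 2 := by
    rintro ⟨h1, h2⟩ hm
    obtain ⟨c, hc⟩ := h1.exists_isTwoColoring hG
    exact (isMonophilic_two_iff hG).1 hm c hc (h2.hasRigidLists hG hc)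
  refine ⟨fun C hC => ⟨fun hm => ?_, good C hC⟩, fun hm => ?_, notMono⟩
  · by_contra h
    exact notMono (bad C hC h) hm
  · obtain ⟨C, hC⟩ := G.exists_isCore
    exact bad C hC fun h => hm (good C hC h)
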